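/- A \emph{pseudoline} is a simple continuous curve in the Euclidean plane that starts and ends at infinity. A set of pseudolines is an \emph{arrangement} if any two of them meet in precisely one point, at a proper crossing. A \emph{pseudo-configuration} is a finite point set $P$ in the plane together with a pseudoline $\ell(p,q)=\ell(q,p)$ for each pair of distinct points $p,q\in P$ such that $\ell(p,q)\cap P=\{p,q\}$ and the pseudolines $\ell(p,q)$ form an arrangement. The \emph{pseudosegment} of $p,q$ is the bounded portion of $\ell(p,q)$ between $p$ and $q$. For $Q\subseteq P$, $\operatorname{conv} Q$ is the complement of the unbounded connected component of the plane minus all pseudosegments between elements of $Q$ (with $\operatorname{conv}\{q\}=\{q\}$), and $Q$ is in \emph{convex position} if no $p\in Q$ lies in $\operatorname{conv}(Q\setminus\{p\})$. \textbf{Theorem.} For every $n\ge 3$ there is a smallest number $b(n)$ such that every pseudo-configuration with at least $b(n)$ points has $n$ points in convex position, and there is a constant $C$ such that \[ b(n)\le 2^{\,n+C\sqrt{n\log n}}\qquad\text{for all } n\ge 3 . \] Moreover $e(n)\le b(n)$ for all $n\ge 3$, where $e(n)$ is the smallest number such that every set of at least $e(n)$ points in the plane, no three of them collinear, has $n$ elements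 in convex position in the usual sense; hence $e(n)\le 2^{n+C\sqrt{n\log n}}$ as well. -/

import Mathlib

/-- The Euclidean plane. -/
abbrev Plane : Type := EuclideanSpace ℝ (Fin 2)

/-- `γ` is a simple continuous curve in the plane that starts and ends at infinity,
and `L` is the set of points that it traces out. -/
def Parametrizes (γ : ℝ → Plane) (L : Set Plane) : Prop :=
  Continuous γ ∧ Function.Injective γ ∧
    Filter.Tendsto γ (Filter.cocompact ℝ) (Filter.cocompact Plane) ∧ Set.range γ = L

/-- A pseudoline: the trace of a simple continuous curve that starts and ends at infinity. -/
def IsPseudoline (L : Set Plane) : Prop :=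
  ∃ γ : ℝ → Plane, Parametrizes γ L

/-- The bounded portion of the pseudoline `L` between its points `p` and `q`, endpoints included
(it does not depend on the parametrization; it is `{p}` if `p = q`). -/
def pseudosegment (L : Set Plane) (p q : Plane) : Set Plane :=
  {x | ∃ γ : ℝ → Plane, Parametrizes γ L ∧
    ∃ a b t : ℝ, γ a = p ∧ γ b = q ∧ t ∈ Set.uIcc a b ∧ γ t = x}

/-- The pseudolines `L` and `M` meet in precisely one point, and there `M` passes from one side
of `L` to another: two points of `M` that are separated on `M` by the common point `x` lie in
different connected components of the complement of `L`. -/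
def CrossesOnce (L M : Set Plane) : Prop :=
  ∃ x : Plane, L ∩ M = {x} ∧
    ∀ y ∈ M, ∀ z ∈ M, y ≠ x → z ≠ x → x ∈ pseudosegment M y z →
      connectedComponentIn Lᶜ y ≠ connectedComponentIn Lᶜ z

/-- An arrangement of pseudolines: any two of them meet in precisely one point, at a proper
crossing (the condition is imposed on both orders of a pair). -/
def IsPseudolineArrangement (A : Set (Set Plane)) : Prop :=
  (∀ L ∈ A, IsPseudoline L) ∧ ∀ L ∈ A, ∀ M ∈ A, L ≠ M → CrossesOnce L M

/-- A pseudo-configuration: a finite set of points in the plane, together with a connecting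
pseudoline `line p q` for each pair of distinct points (the values of `line` at other arguments
play no role). -/
structure PseudoConfiguration where
  /-- the points of the configuration -/
  points : Finset Plane
  /-- the connecting pseudolines -/
  line : Plane → Plane → Set Plane
  line_comm : ∀ p ∈ points, ∀ q ∈ points, p ≠ q → line p q = line q p
  line_inter : ∀ p ∈ points, ∀ q ∈ points, p ≠ q → line p q ∩ (points : Set Plane) = {p, q}
  arrangement : IsPseudolineArrangement
    {L | ∃ p ∈ points, ∃ q ∈ points, p ≠ q ∧ L = line p q}

namespace PseudoConfiguration

/-- The union of the pseudosegments between the elements of `Q`, including the elements of `Q`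
themselves (which matters only if `Q` is a single point). -/
def skeleton (P : PseudoConfiguration) (Q : Set Plane) : Set Plane :=
  Q ∪ {x | ∃ p ∈ Q, ∃ q ∈ Q, p ≠ q ∧ x ∈ pseudosegment (P.line p q) p q}

/-- The convex hull of a set `Q` of points of `P`: the complement of the unbounded connected
component of the complement of the pseudosegments between the elements of `Q`. -/
def hull (P : PseudoConfiguration) (Q : Set Plane) : Set Plane :=
  {x | x ∈ (P.skeleton Q)ᶜ ∧
    ¬ Bornology.IsBounded (connectedComponentIn (P.skeleton Q)ᶜ x)}ᶜ

/-- `Q` is in convex position with respect to `P`: no point of `Q` is in the convex hull of the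
others. -/
def InConvexPosition (P : PseudoConfiguration) (Q : Finset Plane) : Prop :=
  Q ⊆ P.points ∧ ∀ p ∈ Q, p ∉ P.hull ((Q : Set Plane) \ {p})

end PseudoConfiguration

/-- Every pseudo-configuration of size at least `N` has `n` members in convex position. -/
def PseudoESProperty (n N : ℕ) : Prop :=
  ∀ P : PseudoConfiguration, N ≤ P.points.card →
    ∃ Q : Finset Plane, Q.card = n ∧ P.InConvexPosition Q

/-- No three points of the set are collinear. -/
def InGeneralPosition (P : Finset Plane) : Prop :=
  ∀ p ∈ P, ∀ q ∈ P, ∀ r ∈ P, p ≠ q → p ≠ r → q ≠ r → ¬ Collinear ℝ {p, q, r}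

/-- Every set of at least `N` points in general position in the plane has `n` elements in convex
position, in the usual sense of convexity. -/
def ClassicalESProperty (n N : ℕ) : Prop :=
  ∀ P : Finset Plane, InGeneralPosition P → N ≤ P.card →
    ∃ Q : Finset Plane, Q ⊆ P ∧ Q.card = n ∧
      ∀ p ∈ Q, p ∉ convexHull ℝ ((Q : Set Plane) \ {p})

/-! Choose an extreme point `v` of the configuration. The other points are linearly ordered as seen
from `v`, and orienting a triple according to the side of `ℓ(p, q)` that contains the third point
gives a signature that obeys the same exchange axioms as points in the plane sorted from left to
right. It is a transitive coloring of triples, so every `4 ^ L` points contain a cap or a cup of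
`L` points, and by averaging a proportion of at least `2 ^ (-O(L ^ 2))` of all `L`-sets are caps, or
are cups, which are the caps of the opposite orientation.

Let `L = 2 * k + 3` and fix `k + 3` points of the caps, so that each of the other `k` points varies
in its own triangular cell above an edge `c d` of the cap of the fixed points. If `a`, `c`, `d`, `b`
are consecutive on this cap, order the points `p` of the cell by inclusion of the triangles `a p b`.
An antichain contains a long cap or a long cup. A chain contains a long nested chain of one of two
orientations. Nested chains in adjacent cells with opposite orientations form a convex polygon, as
do caps in every second cell. If no `n` points are in convex position, Dilworth's theorem therefore
bounds the product of the sizes of the `k` cells by `2 ^ ((k + 1) * n) * (2 * n) ^ (2 * n)`.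
Comparison with the number of caps bounds the `k`-th power of the number of points, and
`k ≈ √(n log n)` balances the error terms.

Points in general position reduce to pseudo-configurations by a projective map close to the
identity after which no two connecting lines are parallel. -/

open Set Filter Topology

namespace Parametrizes

variable {γ δ : ℝ → Plane} {L : Set Plane}

theorem mem (h : Parametrizes γ L) (t : ℝ) : γ t ∈ L := h.2.2.2 ▸ mem_range_self t

theorem exists_eq (h : Parametrizes γ L) {x : Plane} (hx : x ∈ L) : ∃ t, γ t = x := by
  rwa [← h.2.2.2] at hx

theorem isClosedEmbedding (h : Parametrizes γ L) : IsClosedEmbedding γ :=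
  .of_continuous_injective_isClosedMap h.1 h.2.1
    (isProperMap_iff_tendsto_cocompact.2 ⟨h.1, h.2.2.1⟩).isClosedMap

theorem comp_neg (h : Parametrizes γ L) : Parametrizes (fun t => γ (-t)) L :=
  ⟨h.1.comp continuous_neg, h.2.1.comp neg_injective,
    h.2.2.1.comp (Homeomorph.neg ℝ).isClosedEmbedding.tendsto_cocompact,
    ((Equiv.neg ℝ).surjective.range_comp γ).trans h.2.2.2⟩

theorem exists_reparametrization (h : Parametrizes γ L) (h' : Parametrizes δ L) :
    ∃ φ : ℝ → ℝ, (∀ t, δ (φ t) = γ t) ∧ (StrictMono φ ∨ StrictAnti φ) := by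
  choose φ hφ using fun t => h'.exists_eq (h.mem t)
  have hcont : Continuous φ :=
    h'.isClosedEmbedding.isInducing.continuous_iff.2 (h.1.congr fun t => (hφ t).symm)
  refine ⟨φ, hφ, hcont.strictMono_of_inj fun s t hst => h.2.1 ?_⟩
  rw [← hφ s, ← hφ t, hst]

theorem pseudosegment_eq_image (h : Parametrizes γ L) (a b : ℝ) :
    pseudosegment L (γ a) (γ b) = γ '' uIcc a b := by
  ext x
  constructor
  · rintro ⟨δ, hδ, a', b', t, ha, hb, ht, rfl⟩
    obtain ⟨φ, hφ, hmono⟩ := hδ.exists_reparametrization h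
    obtain rfl : φ a' = a := h.2.1 (by rw [hφ, ha])
    obtain rfl : φ b' = b := h.2.1 (by rw [hφ, hb])
    refine ⟨φ t, ?_, hφ t⟩
    rcases hmono with hφ | hφ
    · exact hφ.monotone.image_uIcc_subset (mem_image_of_mem _ ht)
    · exact hφ.antitone.image_uIcc_subset (mem_image_of_mem _ ht)
  · rintro ⟨t, ht, rfl⟩
    exact ⟨γ, h, a, b, t, rfl, rfl, ht, rfl⟩

theorem not_isBounded_image_Iic (h : Parametrizes γ L) (a : ℝ) :
    ¬ Bornology.IsBounded (γ '' Iic a) := by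
  intro hbdd
  have hesc : ∀ᶠ t in atBot, γ t ∉ closure (γ '' Iic a) :=
    (h.2.2.1.mono_left atBot_le_cocompact).eventually hbdd.isCompact_closure.compl_mem_cocompact
  obtain ⟨t, ht, hta⟩ := (hesc.and (eventually_le_atBot a)).exists
  exact ht (subset_closure (mem_image_of_mem γ hta))

end Parametrizes

section Pseudosegment

variable {L : Set Plane} {x y z w : Plane}

theorem pseudosegment_comm (L : Set Plane) (x y : Plane) :
    pseudosegment L x y = pseudosegment L y x := by
  ext z
  constructor <;> rintro ⟨γ, h, a, b, t, ha, hb, ht, hx⟩ <;>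
    exact ⟨γ, h, b, a, t, hb, ha, uIcc_comm a b ▸ ht, hx⟩

theorem pseudosegment_subset : pseudosegment L x y ⊆ L := by
  rintro _ ⟨γ, h, _, _, t, _, _, _, rfl⟩
  exact h.mem t

namespace IsPseudoline

theorem exists_parametrizes_lt (hL : IsPseudoline L) (hx : x ∈ L) (hy : y ∈ L) (hxy : x ≠ y) :
    ∃ γ a b, Parametrizes γ L ∧ γ a = x ∧ γ b = y ∧ a < b := by
  obtain ⟨γ, h⟩ := hL
  obtain ⟨a, rfl⟩ := h.exists_eq hx
  obtain ⟨b, rfl⟩ := h.exists_eq hy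
  rcases lt_or_gt_of_ne (fun e => hxy (congrArg γ e) : a ≠ b) with hab | hab
  · exact ⟨γ, a, b, h, rfl, rfl, hab⟩
  · exact ⟨_, -a, -b, h.comp_neg, by simp, by simp, neg_lt_neg hab⟩

/-- A coordinate on the pseudoline reduces all statements about betweenness to statements about
real numbers. -/
theorem exists_coordinate (hL : IsPseudoline L) : ∃ f : Plane → ℝ, InjOn f L ∧
    ∀ x ∈ L, ∀ y ∈ L, ∀ z, z ∈ pseudosegment L x y ↔ z ∈ L ∧ f z ∈ uIcc (f x) (f y) := by
  obtain ⟨γ, h⟩ := hL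
  have hinv : ∀ t, Function.invFun γ (γ t) = t := Function.leftInverse_invFun h.2.1
  refine ⟨Function.invFun γ, ?_, ?_⟩
  · rw [← h.2.2.2]
    rintro _ ⟨a, rfl⟩ _ ⟨b, rfl⟩ hab
    rw [hinv, hinv] at hab
    rw [hab]
  · intro x hx y hy z
    obtain ⟨a, rfl⟩ := h.exists_eq hx
    obtain ⟨b, rfl⟩ := h.exists_eq hy
    rw [h.pseudosegment_eq_image, hinv, hinv]
    constructor
    · rintro ⟨t, ht, rfl⟩
      exact ⟨h.mem t, by rwa [hinv]⟩
    · rintro ⟨hz, hzab⟩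
      obtain ⟨c, rfl⟩ := h.exists_eq hz
      exact ⟨c, by rwa [hinv] at hzab, rfl⟩

theorem left_mem_pseudosegment (hL : IsPseudoline L) (hx : x ∈ L) (hy : y ∈ L) :
    x ∈ pseudosegment L x y := by
  obtain ⟨f, -, hf⟩ := hL.exists_coordinate
  exact (hf x hx y hy x).2 ⟨hx, left_mem_uIcc⟩

theorem right_mem_pseudosegment (hL : IsPseudoline L) (hx : x ∈ L) (hy : y ∈ L) :
    y ∈ pseudosegment L x y :=
  pseudosegment_comm L y x ▸ hL.left_mem_pseudosegment hy hx

theorem isPreconnected_pseudosegment (hL : IsPseudoline L) (hx : x ∈ L) (hy : y ∈ L) :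
    IsPreconnected (pseudosegment L x y) := by
  obtain ⟨γ, h⟩ := hL
  obtain ⟨a, rfl⟩ := h.exists_eq hx
  obtain ⟨b, rfl⟩ := h.exists_eq hy
  rw [h.pseudosegment_eq_image]
  exact isPreconnected_uIcc.image _ h.1.continuousOn

theorem mem_pseudosegment_trichotomy (hL : IsPseudoline L) (hx : x ∈ L) (hy : y ∈ L)
    (hz : z ∈ L) :
    x ∈ pseudosegment L y z ∨ y ∈ pseudosegment L x z ∨ z ∈ pseudosegment L x y := by
  obtain ⟨f, -, hf⟩ := hL.exists_coordinate
  simp only [hf x hx y hy, hf y hy z hz, hf x hx z hz, mem_uIcc, hx, hy, hz, true_and]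
  grind

theorem eq_of_mem_pseudosegment (hL : IsPseudoline L) (hz : z ∈ L)
    (hx : x ∈ pseudosegment L y z) (hy : y ∈ pseudosegment L x z) : x = y := by
  have hxL := pseudosegment_subset hx
  have hyL := pseudosegment_subset hy
  obtain ⟨f, hinj, hf⟩ := hL.exists_coordinate
  simp only [hf y hyL z hz, hf x hxL z hz, mem_uIcc] at hx hy
  apply hinj hxL hyL
  grind

theorem eq_of_mem_pseudosegment_of_mem_of_mem (hL : IsPseudoline L) (hx : x ∈ L) (hy : y ∈ L)
    (hz : z ∈ pseudosegment L x y) (hwx : w ∈ pseudosegment L z x)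
    (hwy : w ∈ pseudosegment L z y) : w = z := by
  have hzL := pseudosegment_subset hz
  have hwL := pseudosegment_subset hwx
  obtain ⟨f, hinj, hf⟩ := hL.exists_coordinate
  rw [hf _ hx _ hy] at hz
  rw [hf _ hzL _ hx] at hwx
  rw [hf _ hzL _ hy] at hwy
  apply hinj hwL hzL
  have hz := mem_uIcc.1 hz.2
  have hwx := mem_uIcc.1 hwx.2
  have hwy := mem_uIcc.1 hwy.2
  clear hf hinj
  grind

end IsPseudoline

end Pseudosegment

/-- The points `y` and `z` lie on the same side of the pseudoline `L`: in the same connected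
component of its complement. -/
def SameSide (L : Set Plane) (y z : Plane) : Prop :=
  y ∉ L ∧ z ∉ L ∧ connectedComponentIn Lᶜ y = connectedComponentIn Lᶜ z

/-- The side of the pseudoline `L` that contains `w`, together with `L` itself. -/
def closedSide (L : Set Plane) (w : Plane) : Set Plane := L ∪ {s | SameSide L s w}

section SameSide

variable {L M : Set Plane} {u w x y z : Plane}

theorem SameSide.refl (h : y ∉ L) : SameSide L y y := ⟨h, h, rfl⟩

theorem SameSide.symm (h : SameSide L y z) : SameSide L z y := ⟨h.2.1, h.1, h.2.2.symm⟩

theorem SameSide.trans (h : SameSide L x y) (h' : SameSide L y z) : SameSide L x z :=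
  ⟨h.1, h'.2.1, h.2.2.trans h'.2.2⟩

theorem sameSide_comm : SameSide L y z ↔ SameSide L z y := ⟨SameSide.symm, SameSide.symm⟩

theorem SameSide.left_congr (h : SameSide L x y) : SameSide L x z ↔ SameSide L y z :=
  ⟨h.symm.trans, h.trans⟩

theorem SameSide.right_congr (h : SameSide L x y) : SameSide L z x ↔ SameSide L z y :=
  ⟨fun h' => h'.trans h, fun h' => h'.trans h.symm⟩

theorem IsPseudoline.sameSide_of_disjoint (hM : IsPseudoline M) (hy : y ∈ M) (hz : z ∈ M)
    (h : Disjoint (pseudosegment M y z) L) : SameSide L y z := by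
  rw [← subset_compl_iff_disjoint_right] at h
  have hyM := hM.left_mem_pseudosegment hy hz
  have hzM := hM.right_mem_pseudosegment hy hz
  exact ⟨h hyM, h hzM, connectedComponentIn_eq
    ((hM.isPreconnected_pseudosegment hy hz).subset_connectedComponentIn hyM h hzM)⟩

namespace CrossesOnce

theorem exists_mem (h : CrossesOnce L M) : ∃ x ∈ L, x ∈ M := by
  obtain ⟨x, hx, -⟩ := h
  exact ⟨x, hx.ge rfl⟩

theorem eq_of_mem (h : CrossesOnce L M) (hxL : x ∈ L) (hxM : x ∈ M) (hyL : y ∈ L) (hyM : y ∈ M) :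
    x = y := by
  obtain ⟨w, hw, -⟩ := h
  exact (hw.le ⟨hxL, hxM⟩ : x = w).trans (hw.le ⟨hyL, hyM⟩ : y = w).symm

theorem sameSide_iff (hLM : CrossesOnce L M) (hM : IsPseudoline M) (hxL : x ∈ L) (hxM : x ∈ M)
    (hy : y ∈ M) (hz : z ∈ M) (hyx : y ≠ x) (hzx : z ≠ x) :
    SameSide L y z ↔ x ∉ pseudosegment M y z := by
  obtain ⟨x', hx', hsep⟩ := id hLM
  obtain rfl : x = x' := hx'.le ⟨hxL, hxM⟩
  refine ⟨fun hs hx => hsep y hy z hz hyx hzx hx hs.2.2, fun hx => ?_⟩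
  refine hM.sameSide_of_disjoint hy hz (disjoint_left.2 fun w hw hwL => hx ?_)
  rwa [hLM.eq_of_mem hxL hxM hwL (pseudosegment_subset hw)]

theorem notMem_of_sameSide (hLM : CrossesOnce L M) (hM : IsPseudoline M) (h : SameSide L y z)
    (hy : y ∈ M) (hz : z ∈ M) (hu : u ∈ pseudosegment M y z) : u ∉ L := fun huL =>
  (hLM.sameSide_iff hM huL (pseudosegment_subset hu) hy hz (fun e => h.1 (e ▸ huL))
    (fun e => h.2.1 (e ▸ huL))).1 h hu

theorem pseudosegment_subset_closedSide (hLM : CrossesOnce L M) (hM : IsPseudoline M)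
    (hy : y ∈ M) (hz : z ∈ M) (hyw : y ∈ closedSide L w) (hzw : z ∈ closedSide L w) :
    pseudosegment M y z ⊆ closedSide L w := by
  intro u hu
  refine or_iff_not_imp_left.2 fun huL => ?_
  have huM := pseudosegment_subset hu
  obtain ⟨x, hxL, hxM⟩ := hLM.exists_mem
  have hux : u ≠ x := fun e => huL (e ▸ hxL)
  have of_notMem : ∀ v ∈ M, v ∈ closedSide L w → x ∉ pseudosegment M u v → SameSide L u w := by
    intro v hv hvw hx
    have hvx : v ≠ x := fun e => hx (e ▸ hM.right_mem_pseudosegment huM hv)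
    have hvL : v ∉ L := fun hvL => hvx (hLM.eq_of_mem hvL hv hxL hxM)
    exact ((hLM.sameSide_iff hM hxL hxM huM hv hux hvx).2 hx).trans (hvw.resolve_left hvL)
  by_contra h
  exact hux (hM.eq_of_mem_pseudosegment_of_mem_of_mem hy hz hu
    (by_contra fun hx => h (of_notMem y hy hyw hx))
    (by_contra fun hx => h (of_notMem z hz hzw hx))).symm

theorem sameSide_of_mem (hLM : CrossesOnce L M) (hM : IsPseudoline M) (h : SameSide L y z)
    (hy : y ∈ M) (hz : z ∈ M) (hu : u ∈ pseudosegment M y z) : SameSide L u z :=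
  (hLM.pseudosegment_subset_closedSide hM hy hz (.inr h) (.inr (.refl h.2.1)) hu).resolve_left
    (hLM.notMem_of_sameSide hM h hy hz hu)

end CrossesOnce

end SameSide

namespace PseudoConfiguration

/-- The points of a pseudo-configuration, as a type. -/
abbrev Point (P : PseudoConfiguration) : Type := {p // p ∈ P.points}

/-- The connecting pseudoline of two points of a pseudo-configuration. -/
def lineThrough (P : PseudoConfiguration) (a b : P.Point) : Set Plane := P.line a b

/-- The pseudosegment between two points of a pseudo-configuration. -/
def seg (P : PseudoConfiguration) (a b : P.Point) : Set Plane :=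
  pseudosegment (P.lineThrough a b) a b

variable {P : PseudoConfiguration} {a b c d v w x y z : P.Point} {s t u : Plane}

theorem lineThrough_comm (a b : P.Point) : P.lineThrough a b = P.lineThrough b a := by
  rcases eq_or_ne a b with rfl | h
  · rfl
  · exact P.line_comm a a.2 b b.2 (Subtype.coe_ne_coe.2 h)

theorem seg_comm (a b : P.Point) : P.seg a b = P.seg b a := by
  rw [seg, seg, lineThrough_comm, pseudosegment_comm]

theorem seg_subset_lineThrough : P.seg a b ⊆ P.lineThrough a b := pseudosegment_subset

theorem mem_lineThrough (h : a ≠ b) : (c : Plane) ∈ P.lineThrough a b ↔ c = a ∨ c = b := by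
  have hc : (c : Plane) ∈ P.line a b ∩ P.points ↔ (c : Plane) ∈ ({↑a, ↑b} : Set Plane) := by
    rw [P.line_inter a a.2 b b.2 (Subtype.coe_ne_coe.2 h)]
  simpa [Subtype.coe_inj, lineThrough] using hc

theorem left_mem_lineThrough (h : a ≠ b) : (a : Plane) ∈ P.lineThrough a b :=
  (mem_lineThrough h).2 (.inl rfl)

theorem right_mem_lineThrough (h : a ≠ b) : (b : Plane) ∈ P.lineThrough a b :=
  (mem_lineThrough h).2 (.inr rfl)

theorem notMem_lineThrough (h : a ≠ b) (ha : c ≠ a) (hb : c ≠ b) :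
    (c : Plane) ∉ P.lineThrough a b := by
  rw [mem_lineThrough h]
  tauto

theorem isPseudoline_lineThrough (h : a ≠ b) : IsPseudoline (P.lineThrough a b) :=
  P.arrangement.1 _ ⟨a, a.2, b, b.2, Subtype.coe_ne_coe.2 h, rfl⟩

theorem crossesOnce (h : a ≠ b) (h' : c ≠ d) (hne : P.lineThrough a b ≠ P.lineThrough c d) :
    CrossesOnce (P.lineThrough a b) (P.lineThrough c d) :=
  P.arrangement.2 _ ⟨a, a.2, b, b.2, Subtype.coe_ne_coe.2 h, rfl⟩ _
    ⟨c, c.2, d, d.2, Subtype.coe_ne_coe.2 h', rfl⟩ hne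

theorem crossesOnce_of_ne (h : a ≠ b) (h' : c ≠ d) (hac : a ≠ c) (had : a ≠ d) :
    CrossesOnce (P.lineThrough a b) (P.lineThrough c d) :=
  crossesOnce h h' fun e => notMem_lineThrough h' hac had (e ▸ left_mem_lineThrough h)

theorem crossesOnce_of_ne' (h : a ≠ b) (h' : c ≠ d) (hac : a ≠ c) (had : a ≠ d) :
    CrossesOnce (P.lineThrough c d) (P.lineThrough a b) :=
  crossesOnce h' h fun e => notMem_lineThrough h' hac had (e ▸ left_mem_lineThrough h)

theorem ne_of_mem_lineThrough (hs : s ∈ P.lineThrough a b) (hab : a ≠ b) (hca : c ≠ a)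
    (hcb : c ≠ b) : s ≠ c :=
  fun e => notMem_lineThrough hab hca hcb (e ▸ hs)

theorem sameSide_iff_notMem_pseudosegment (hab : a ≠ b) (hac : a ≠ c) (hbc : b ≠ c)
    (hs : s ∈ P.lineThrough a b) (ht : t ∈ P.lineThrough a b) (hsa : s ≠ a) (hta : t ≠ a) :
    SameSide (P.lineThrough a c) s t ↔ (a : Plane) ∉ pseudosegment (P.lineThrough a b) s t := by
  have hcross : CrossesOnce (P.lineThrough a c) (P.lineThrough a b) := by
    rw [lineThrough_comm a c]
    exact crossesOnce_of_ne hac.symm hab hac.symm hbc.symm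
  exact hcross.sameSide_iff (isPseudoline_lineThrough hab) (left_mem_lineThrough hac)
    (left_mem_lineThrough hab) hs ht hsa hta

theorem exists_mem_seg_of_not_sameSide (hyz : y ≠ z) (h : ¬ SameSide (P.lineThrough a b) y z) :
    ∃ s ∈ P.seg y z, s ∈ P.lineThrough a b := by
  by_contra! hdisj
  exact h ((isPseudoline_lineThrough hyz).sameSide_of_disjoint (left_mem_lineThrough hyz)
    (right_mem_lineThrough hyz) (disjoint_left.2 hdisj))

theorem sameSide_of_mem_seg (hac : a ≠ c) (hab : a ≠ b) (hbc : b ≠ c) (hs : s ∈ P.seg b c)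
    (hsb : s ≠ b) : SameSide (P.lineThrough a b) s c := by
  rw [lineThrough_comm]
  refine (sameSide_iff_notMem_pseudosegment hbc hab.symm hac.symm (seg_subset_lineThrough hs)
    (right_mem_lineThrough hbc) hsb (Subtype.coe_ne_coe.2 hbc.symm)).2 fun hb => hsb ?_
  exact (isPseudoline_lineThrough hbc).eq_of_mem_pseudosegment (right_mem_lineThrough hbc) hs hb

/-- Both sides say that `c` does not separate `x` on `P.lineThrough c x` from the point where this
pseudoline crosses the pseudosegment between `y` and `z`. -/
theorem sameSide_exchange (hcx : c ≠ x) (hcy : c ≠ y) (hcz : c ≠ z) (hcv : c ≠ v) (hxy : x ≠ y)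
    (hxv : x ≠ v) (hyz : y ≠ z) (h : ¬ SameSide (P.lineThrough c x) y z)
    (h' : SameSide (P.lineThrough c v) y z) :
    SameSide (P.lineThrough c y) x z ↔ SameSide (P.lineThrough c v) x y := by
  obtain ⟨s, hs, hsx⟩ := exists_mem_seg_of_not_sameSide hyz h
  have hsy : s ≠ y := ne_of_mem_lineThrough hsx hcx hcy.symm hxy.symm
  have hsc : s ≠ c := ne_of_mem_lineThrough (seg_subset_lineThrough hs) hyz hcy hcz
  have hx : (x : Plane) ≠ c := Subtype.coe_ne_coe.2 hcx.symm
  have hsz : SameSide (P.lineThrough c y) s z := sameSide_of_mem_seg hcz hcy hyz hs hsy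
  have hsy' : SameSide (P.lineThrough c v) s y := by
    rw [seg_comm] at hs
    exact (crossesOnce_of_ne hcv hyz.symm hcz hcy).sameSide_of_mem
      (isPseudoline_lineThrough hyz.symm) h'.symm (left_mem_lineThrough hyz.symm)
      (right_mem_lineThrough hyz.symm) hs
  rw [← hsz.right_congr, ← hsy'.right_congr,
    sameSide_iff_notMem_pseudosegment hcx hcy hxy (right_mem_lineThrough hcx) hsx hx hsc,
    sameSide_iff_notMem_pseudosegment hcx hcv hxv (right_mem_lineThrough hcx) hsx hx hsc]

/-- Pasch's argument: `s₁` and `s₃` are both on the side of `P.lineThrough y z` that contains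
`x`. -/
theorem crossing_notMem_pseudosegment (hab : a ≠ b) (hxy : x ≠ y) (hxz : x ≠ z) (hyz : y ≠ z)
    (hay : a ≠ y) (haz : a ≠ z) (hby : b ≠ y) (hbz : b ≠ z) {s₁ s₂ s₃ : Plane}
    (h₁ : s₁ ∈ P.seg x y) (h₂ : s₂ ∈ P.seg y z) (h₃ : s₃ ∈ P.seg x z)
    (l₁ : s₁ ∈ P.lineThrough a b) (l₃ : s₃ ∈ P.lineThrough a b) :
    s₂ ∉ pseudosegment (P.lineThrough a b) s₁ s₃ := by
  intro hs
  have hs₁x : SameSide (P.lineThrough y z) s₁ x := by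
    rw [lineThrough_comm]
    exact sameSide_of_mem_seg hxz.symm hyz.symm hxy.symm (seg_comm x y ▸ h₁)
      (ne_of_mem_lineThrough l₁ hab hay.symm hby.symm)
  have hs₃x : SameSide (P.lineThrough y z) s₃ x :=
    sameSide_of_mem_seg hxy.symm hyz hxz.symm (seg_comm x z ▸ h₃)
      (ne_of_mem_lineThrough l₃ hab haz.symm hbz.symm)
  exact (crossesOnce_of_ne' hab hyz hay haz).notMem_of_sameSide (isPseudoline_lineThrough hab)
    (hs₁x.trans hs₃x.symm) l₁ l₃ hs (seg_subset_lineThrough h₂)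

theorem sameSide_of_not_sameSide_of_not_sameSide (hab : a ≠ b) (hax : a ≠ x) (hbx : b ≠ x)
    (hay : a ≠ y) (hby : b ≠ y) (haz : a ≠ z) (hbz : b ≠ z)
    (h : ¬ SameSide (P.lineThrough a b) x y) (h' : ¬ SameSide (P.lineThrough a b) y z) :
    SameSide (P.lineThrough a b) x z := by
  by_contra h''
  have ne_of_not_sameSide : ∀ {p q : P.Point}, a ≠ p → b ≠ p →
      ¬ SameSide (P.lineThrough a b) p q → p ≠ q := by
    rintro p _ hap hbp hpq rfl
    exact hpq (.refl (notMem_lineThrough hab hap.symm hbp.symm))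
  have hxy := ne_of_not_sameSide hax hbx h
  have hyz := ne_of_not_sameSide hay hby h'
  have hxz := ne_of_not_sameSide hax hbx h''
  obtain ⟨s₁, h₁, l₁⟩ := exists_mem_seg_of_not_sameSide hxy h
  obtain ⟨s₂, h₂, l₂⟩ := exists_mem_seg_of_not_sameSide hyz h'
  obtain ⟨s₃, h₃, l₃⟩ := exists_mem_seg_of_not_sameSide hxz h''
  rcases (isPseudoline_lineThrough hab).mem_pseudosegment_trichotomy l₁ l₂ l₃ with k | k | k
  · exact crossing_notMem_pseudosegment hab hyz.symm hxz.symm hxy.symm hay hax hby hbx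
      (seg_comm y z ▸ h₂) (seg_comm x y ▸ h₁) (seg_comm x z ▸ h₃) l₂ l₃ k
  · exact crossing_notMem_pseudosegment hab hxy hxz hyz hay haz hby hbz h₁ h₂ h₃ l₁ l₃ k
  · exact crossing_notMem_pseudosegment hab hxy.symm hyz hxz hax haz hbx hbz (seg_comm x y ▸ h₁)
      h₃ h₂ l₁ l₂ k

theorem exists_mem_seg_of_separated (hva : v ≠ a) (hvb : v ≠ b) (hvc : v ≠ c) (hab : a ≠ b)
    (hbc : b ≠ c) (h₁ : ¬ SameSide (P.lineThrough v a) b c)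
    (h₂ : ¬ SameSide (P.lineThrough v b) a c) :
    ∃ s ∈ P.seg b c, s ∈ P.lineThrough v a ∧
      (v : Plane) ∈ pseudosegment (P.lineThrough v a) a s := by
  obtain ⟨s, hs, hsa⟩ := exists_mem_seg_of_not_sameSide hbc h₁
  refine ⟨s, hs, hsa, ?_⟩
  have hsc : SameSide (P.lineThrough v b) s c := sameSide_of_mem_seg hvc hvb hbc hs
    (ne_of_mem_lineThrough hsa hva hvb.symm hab.symm)
  rwa [← hsc.right_congr, sameSide_iff_notMem_pseudosegment hva hvb hab
    (right_mem_lineThrough hva) hsa (Subtype.coe_ne_coe.2 hva.symm)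
    (ne_of_mem_lineThrough (seg_subset_lineThrough hs) hbc hvb hvc), not_not] at h₂

theorem separated_of_separated_of_separated (hva : v ≠ a) (hvb : v ≠ b) (hvc : v ≠ c)
    (hab : a ≠ b) (hac : a ≠ c) (hbc : b ≠ c) (h₁ : ¬ SameSide (P.lineThrough v a) b c)
    (h₂ : ¬ SameSide (P.lineThrough v b) a c) : ¬ SameSide (P.lineThrough v c) a b := by
  obtain ⟨s, hs, hsa, hv⟩ := exists_mem_seg_of_separated hva hvb hvc hab hbc h₁ h₂
  rw [seg_comm] at hs
  have hsb : SameSide (P.lineThrough v c) s b := sameSide_of_mem_seg hvb hvc hbc.symm hs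
    (ne_of_mem_lineThrough hsa hva hvc.symm hac.symm)
  rwa [← hsb.right_congr, sameSide_iff_notMem_pseudosegment hva hvc hac
    (right_mem_lineThrough hva) hsa (Subtype.coe_ne_coe.2 hva.symm)
    (ne_of_mem_lineThrough (seg_subset_lineThrough hs) hbc.symm hvc hvb), not_not]

theorem not_sameSide_of_mem_pseudosegment (hva : v ≠ a) (hvb : v ≠ b) (hvc : v ≠ c) (hab : a ≠ b)
    (hac : a ≠ c) (hbc : b ≠ c) (hs : s ∈ P.lineThrough b c) (hsa : s ∈ P.lineThrough v a)
    (hcs : (c : Plane) ∈ pseudosegment (P.lineThrough b c) b s)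
    (h : SameSide (P.lineThrough v c) a b) : ¬ SameSide (P.lineThrough v b) a c := by
  have hsb : s ≠ b := ne_of_mem_lineThrough hsa hva hvb.symm hab.symm
  have hsc : s ≠ c := ne_of_mem_lineThrough hsa hva hvc.symm hac.symm
  have hsv : s ≠ v := ne_of_mem_lineThrough hs hbc hvb hvc
  have hav : (a : Plane) ≠ v := Subtype.coe_ne_coe.2 hva.symm
  have hbc' : (b : Plane) ≠ c := Subtype.coe_ne_coe.2 hbc
  have hbs : ¬ SameSide (P.lineThrough v c) b s := by
    rw [lineThrough_comm, sameSide_iff_notMem_pseudosegment hbc.symm hvc.symm hvb.symm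
      (right_mem_lineThrough hbc.symm) (lineThrough_comm b c ▸ hs) hbc' hsc, not_not,
      lineThrough_comm]
    exact hcs
  have hv : (v : Plane) ∈ pseudosegment (P.lineThrough v a) a s := by
    rwa [← h.left_congr, sameSide_iff_notMem_pseudosegment hva hvc hac
      (right_mem_lineThrough hva) hsa hav hsv, not_not] at hbs
  have hcs' : SameSide (P.lineThrough v b) c s := by
    rw [lineThrough_comm, sameSide_iff_notMem_pseudosegment hbc hvb.symm hvc.symm
      (right_mem_lineThrough hbc) hs hbc'.symm hsb]
    exact fun hb => hbc' ((isPseudoline_lineThrough hbc).eq_of_mem_pseudosegment hs hb hcs)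
  rwa [hcs'.right_congr, sameSide_iff_notMem_pseudosegment hva hvb hab
    (right_mem_lineThrough hva) hsa hav hsv, not_not]

theorem not_sameSide_of_sameSide_of_sameSide (hva : v ≠ a) (hvb : v ≠ b) (hvc : v ≠ c)
    (hab : a ≠ b) (hac : a ≠ c) (hbc : b ≠ c) (h₁ : SameSide (P.lineThrough v a) b c)
    (h₂ : SameSide (P.lineThrough v b) a c) : ¬ SameSide (P.lineThrough v c) a b := by
  intro h₃
  have hcross := crossesOnce_of_ne hva hbc hvb hvc
  have hM := isPseudoline_lineThrough hbc
  have hb := left_mem_lineThrough hbc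
  have hc := right_mem_lineThrough hbc
  obtain ⟨s, hsa, hsbc⟩ := hcross.exists_mem
  rcases hM.mem_pseudosegment_trichotomy hsbc hb hc with hs | hs | hs
  · exact hcross.notMem_of_sameSide hM h₁ hb hc hs hsa
  · refine not_sameSide_of_mem_pseudosegment hva hvc hvb hac hab hbc.symm
      (lineThrough_comm b c ▸ hsbc) hsa ?_ h₂ h₃
    rwa [lineThrough_comm, pseudosegment_comm]
  · refine not_sameSide_of_mem_pseudosegment hva hvb hvc hab hac hbc hsbc hsa ?_ h₃ h₂
    rwa [pseudosegment_comm]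

/-- The hypotheses say that `v` is in the triangle `a`, `b`, `c`: the segment from `a` through `v`
leaves it at a point of the opposite side. -/
theorem mem_closedSide_of_separated (hva : v ≠ a) (hvb : v ≠ b) (hvc : v ≠ c) (hab : a ≠ b)
    (hbc : b ≠ c) (hxy : x ≠ y) (h₁ : ¬ SameSide (P.lineThrough v a) b c)
    (h₂ : ¬ SameSide (P.lineThrough v b) a c) (ka : ↑a ∈ closedSide (P.lineThrough x y) u)
    (kb : ↑b ∈ closedSide (P.lineThrough x y) u) (kc : ↑c ∈ closedSide (P.lineThrough x y) u) :
    ↑v ∈ closedSide (P.lineThrough x y) u := by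
  have seg_subset : ∀ {p q : P.Point} {s t : Plane}, p ≠ q → s ∈ P.lineThrough p q →
      t ∈ P.lineThrough p q → s ∈ closedSide (P.lineThrough x y) u →
      t ∈ closedSide (P.lineThrough x y) u →
      pseudosegment (P.lineThrough p q) s t ⊆ closedSide (P.lineThrough x y) u := by
    intro p q s t hpq hs ht hsu htu
    by_cases heq : P.lineThrough x y = P.lineThrough p q
    · exact fun r hr => .inl (heq ▸ pseudosegment_subset hr)
    · exact (crossesOnce hxy hpq heq).pseudosegment_subset_closedSide
        (isPseudoline_lineThrough hpq) hs ht hsu htu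
  obtain ⟨s, hs, hsa, hv⟩ := exists_mem_seg_of_separated hva hvb hvc hab hbc h₁ h₂
  exact seg_subset hva (right_mem_lineThrough hva) hsa ka (seg_subset hbc
    (left_mem_lineThrough hbc) (right_mem_lineThrough hbc) kb kc hs) hv

end PseudoConfiguration

/-- An orientation of the triples of a linearly ordered set that behaves like the orientation of
the triples of a planar point set, ordered from left to right; `o p q r` stands for a clockwise
triple, so that it says of `p < q < r` that they form a cap. The last axiom is `exchange` for a
point `v` at infinity, for which `o c v y` means `y < c`. -/
structure IsOrientation {α : Type*} [LinearOrder α] (o : α → α → α → Prop) : Prop where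
  cyc : ∀ p q r, p ≠ q → q ≠ r → p ≠ r → o p q r → o q r p
  swap : ∀ p q r, p ≠ q → q ≠ r → p ≠ r → (o q p r ↔ ¬ o p q r)
  exchange : ∀ c x y z v, c ≠ x → c ≠ y → c ≠ z → c ≠ v → x ≠ y → x ≠ z → x ≠ v → y ≠ z → y ≠ v →
    z ≠ v → ¬ (o c x y ↔ o c x z) → (o c v y ↔ o c v z) →
    ((o c y x ↔ o c y z) ↔ (o c v x ↔ o c v y))
  exchange_bot : ∀ c x y z, c ≠ x → c ≠ y → c ≠ z → x ≠ y → x ≠ z → y ≠ z →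
    ¬ (o c x y ↔ o c x z) → (c < y ↔ c < z) → ((o c y x ↔ o c y z) ↔ (c < x ↔ c < y))

namespace IsOrientation

variable {α : Type*} [LinearOrder α] {o : α → α → α → Prop} {a b i j k l p q r s : α}

theorem cyc_of_lt (hswap : ∀ p q r, p ≠ q → (o q p r ↔ ¬ o p q r))
    (hlt : ∀ p q r, p < q → q < r → (o p q r ↔ o q r p) ∧ (o q r p ↔ o r p q))
    (hpq : p ≠ q) (hqr : q ≠ r) (hpr : p ≠ r) (h : o p q r) : o q r p := by
  have := hswap p q r hpq
  have := hswap q r p hqr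
  have := hswap p r q hpr
  rcases lt_or_gt_of_ne hpq with h₁ | h₁ <;> rcases lt_or_gt_of_ne hqr with h₂ | h₂ <;>
    rcases lt_or_gt_of_ne hpr with h₃ | h₃ <;> grind

variable (ho : IsOrientation o)

include ho

theorem rot (hpq : p ≠ q) (hqr : q ≠ r) (hpr : p ≠ r) : o p q r ↔ o q r p :=
  ⟨ho.cyc p q r hpq hqr hpr, fun h => ho.cyc r p q hpr.symm hpq hqr.symm
    (ho.cyc q r p hqr hpr.symm hpq.symm h)⟩

theorem swap' (hpq : p ≠ q) (hqr : q ≠ r) (hpr : p ≠ r) : o p r q ↔ ¬ o p q r := by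
  rw [ho.rot hpr hqr.symm hpq, ho.rot hpq hqr hpr]
  exact ho.swap q r p hqr hpr.symm hpq.symm

theorem neg : IsOrientation fun p q r => ¬ o p q r where
  cyc _ _ _ hpq hqr hpr h h' := h ((ho.rot hpq hqr hpr).2 h')
  swap _ _ _ hpq hqr hpr := not_congr (ho.swap _ _ _ hpq hqr hpr)
  exchange := by simpa only [not_iff_not] using ho.exchange
  exchange_bot := by simpa only [not_iff_not] using ho.exchange_bot

theorem iff_of_iff_fst (hij : i < j) (hjk : j < k) (hkl : k < l) (h : o i j k ↔ o i k l) :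
    o i j k ↔ o i j l := by
  have hik := hij.trans hjk
  have := ho.exchange_bot i j k l hij.ne hik.ne (hik.trans hkl).ne hjk.ne (hjk.trans hkl).ne hkl.ne
  have := ho.swap' hij.ne hjk.ne hik.ne
  grind

theorem iff_of_iff_snd (hij : i < j) (hjk : j < k) (hkl : k < l) (h : o i j k ↔ o j k l) :
    o i j k ↔ o i j l := by
  have hjl := hjk.trans hkl
  have := ho.exchange_bot j i k l hij.ne' hjk.ne hjl.ne (hij.trans hjk).ne (hij.trans hjl).ne hkl.ne
  have := ho.swap i j k hij.ne hjk.ne (hij.trans hjk).ne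
  have := ho.swap i j l hij.ne hjl.ne (hij.trans hjl).ne
  have := ho.rot hij.ne hjk.ne (hij.trans hjk).ne
  grind

theorem iff_of_iff_trd (hij : i < j) (hjk : j < k) (hkl : k < l) (h : o i j k ↔ o j k l) :
    o i j k ↔ o i k l := by
  have hik := hij.trans hjk
  have hil := hik.trans hkl
  have := ho.exchange_bot k l i j hkl.ne hik.ne' hjk.ne' hil.ne' (hjk.trans hkl).ne' hij.ne
  have := ho.rot hij.ne hjk.ne hik.ne
  have := ho.rot hjk.ne hkl.ne (hjk.trans hkl).ne
  have := ho.rot hik.ne hkl.ne hil.ne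
  have := ho.rot hik.ne' hij.ne hjk.ne'
  have := ho.swap i k l hik.ne hkl.ne hil.ne
  grind

theorem iff_of_iff_fth (hij : i < j) (hjk : j < k) (hkl : k < l) (h : o i j l ↔ o j k l) :
    o i j l ↔ o i k l := by
  have hik := hij.trans hjk
  have hjl := hjk.trans hkl
  have hil := hij.trans hjl
  have := ho.exchange_bot l k i j hkl.ne' hil.ne' hjl.ne' hik.ne' hjk.ne' hij.ne
  have := ho.rot hil.ne hkl.ne' hik.ne
  have := ho.rot hjk.ne hkl.ne hjl.ne
  have := ho.rot hik.ne hkl.ne hil.ne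
  have := ho.rot hil.ne' hij.ne hjl.ne'
  have := ho.swap k l i hkl.ne hil.ne' hik.ne'
  have := ho.swap k l j hkl.ne hjl.ne' hjk.ne'
  have := ho.swap i l k hil.ne hkl.ne' hik.ne
  grind

end IsOrientation

namespace PseudoConfiguration

variable {P : PseudoConfiguration} {S : Finset P.Point} {a b c d v f r z : P.Point}

/-- All points of `S` other than `v` and `f` are on one side of the pseudoline of `v` and `f`. -/
def IsExtremePair (S : Finset P.Point) (v f : P.Point) : Prop :=
  v ≠ f ∧ ∀ r ∈ S, ∀ s ∈ S, r ≠ v → r ≠ f → s ≠ v → s ≠ f → SameSide (P.lineThrough v f) r s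

theorem IsExtremePair.insert_of_sameSide (h : IsExtremePair S v f) (hzv : z ≠ v) (hzf : z ≠ f)
    (hz : ∀ r ∈ S, r ≠ v → r ≠ f → SameSide (P.lineThrough v f) z r) :
    IsExtremePair (insert z S) v f := by
  refine ⟨h.1, fun r hr s hs hrv hrf hsv hsf => ?_⟩
  rcases Finset.mem_insert.1 hr with rfl | hr' <;> rcases Finset.mem_insert.1 hs with rfl | hs'
  · exact .refl (notMem_lineThrough h.1 hzv hzf)
  · exact hz s hs' hsv hsf
  · exact (hz r hr' hrv hrf).symm
  · exact h.2 r hr' s hs' hrv hrf hsv hsf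

/-- The pair is found by rotating a pseudoline about `z` until it has as many points of `S` as
possible on one side. -/
theorem exists_isExtremePair_insert_of_not_separated (hS : 2 ≤ S.card) (hz : z ∉ S)
    (h : ∀ a ∈ S, ∀ b ∈ S, ∀ c ∈ S, a ≠ b → a ≠ c → b ≠ c →
      ¬ SameSide (P.lineThrough z a) b c → SameSide (P.lineThrough z b) a c) :
    ∃ w ∈ S, IsExtremePair (insert z S) z w := by
  classical
  have hne : ∀ a ∈ S, z ≠ a := fun a ha e => hz (e ▸ ha)
  let F : P.Point × P.Point → Finset P.Point :=
    fun q => S.filter fun r => r ≠ q.1 ∧ SameSide (P.lineThrough z q.1) q.2 r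
  obtain ⟨⟨w, s⟩, hws, hmax⟩ := S.offDiag.exists_max_image (fun q => (F q).card) (by
    obtain ⟨a, ha, b, hb, hab⟩ := Finset.one_lt_card.1 hS
    exact ⟨(a, b), Finset.mem_offDiag.2 ⟨ha, hb, hab⟩⟩)
  have hw : w ∈ S := (Finset.mem_offDiag.1 hws).1
  suffices all_sameSide : ∀ u ∈ S, u ≠ w → SameSide (P.lineThrough z w) s u by
    refine ⟨w, hw, hne w hw, fun r hr t ht hrz hrw htz htw => ?_⟩
    exact (all_sameSide r (Finset.mem_of_mem_insert_of_ne hr hrz) hrw).symm.trans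
      (all_sameSide t (Finset.mem_of_mem_insert_of_ne ht htz) htw)
  intro u hu huw
  by_contra hsu
  have hsub : insert w (F (w, s)) ⊆ F (u, w) := by
    intro r hr
    rcases Finset.mem_insert.1 hr with rfl | hr
    · exact Finset.mem_filter.2 ⟨hw, huw.symm,
        .refl (notMem_lineThrough (hne u hu) (hne _ hw).symm huw.symm)⟩
    · obtain ⟨hrS, hrw, hsr⟩ := Finset.mem_filter.1 hr
      have hru : r ≠ u := fun e => hsu (e ▸ hsr)
      exact Finset.mem_filter.2 ⟨hrS, hru, h w hw u hu r hrS huw.symm hrw.symm hru.symm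
        fun k => hsu (hsr.trans k.symm)⟩
  have hlt : (F (w, s)).card < (F (u, w)).card := by
    have := Finset.card_le_card hsub
    rwa [Finset.card_insert_of_notMem (by simp [F])] at this
  exact (hmax (u, w) (Finset.mem_offDiag.2 ⟨hu, hw, huw⟩)).not_gt hlt

theorem IsExtremePair.exists_insert (h : IsExtremePair S v f) (hv : v ∈ S) (hf : f ∈ S)
    (hz : z ∉ S) (hr : r ∈ S) (hrv : r ≠ v) (hrf : r ≠ f)
    (hzr : ¬ SameSide (P.lineThrough v f) z r) : ∃ w ∈ S, IsExtremePair (insert z S) z w := by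
  have hne : ∀ a ∈ S, z ≠ a := fun a ha e => hz (e ▸ ha)
  have mem_closedSide : ∀ a ∈ S, (a : Plane) ∈ closedSide (P.lineThrough v f) r := by
    intro a ha
    by_cases hav : a = v
    · exact .inl ((mem_lineThrough h.1).2 (.inl hav))
    by_cases haf : a = f
    · exact .inl ((mem_lineThrough h.1).2 (.inr haf))
    exact .inr (h.2 a ha r hr hav haf hrv hrf)
  refine exists_isExtremePair_insert_of_not_separated (Finset.one_lt_card.2 ⟨v, hv, f, hf, h.1⟩) hz
    fun a ha b hb c hc hab _ hbc h₁ => ?_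
  by_contra h₂
  rcases mem_closedSide_of_separated (hne a ha) (hne b hb) (hne c hc) hab hbc h.1 h₁ h₂
    (mem_closedSide a ha) (mem_closedSide b hb) (mem_closedSide c hc) with hz | hz
  · exact notMem_lineThrough h.1 (hne v hv) (hne f hf) hz
  · exact hzr hz

theorem exists_isExtremePair (S : Finset P.Point) (hS : 2 ≤ S.card) :
    ∃ v ∈ S, ∃ f ∈ S, IsExtremePair S v f := by
  induction S using Finset.induction_on with
  | empty => simp at hS
  | insert z S hz ih =>
    rw [Finset.card_insert_of_notMem hz] at hS
    have hz_mem := Finset.mem_insert_self z S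
    rcases (show S.card = 1 ∨ 2 ≤ S.card by omega) with hS | hS
    · obtain ⟨s, rfl⟩ := Finset.card_eq_one.1 hS
      refine ⟨z, hz_mem, s, by simp, by simpa using hz, fun r hr _ _ h₁ h₂ => ?_⟩
      simp [h₁, h₂] at hr
    obtain ⟨v, hv, f, hf, h⟩ := ih hS
    by_cases hzr : ∀ r ∈ S, r ≠ v → r ≠ f → SameSide (P.lineThrough v f) z r
    · exact ⟨v, Finset.mem_insert_of_mem hv, f, Finset.mem_insert_of_mem hf,
        h.insert_of_sameSide (ne_of_mem_of_not_mem hv hz).symm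
          (ne_of_mem_of_not_mem hf hz).symm hzr⟩
    · push Not at hzr
      obtain ⟨r, hr, hrv, hrf, hzr⟩ := hzr
      obtain ⟨w, hw, hzw⟩ := h.exists_insert hv hf hz hr hrv hrf hzr
      exact ⟨z, hz_mem, w, Finset.mem_insert_of_mem hw, hzw⟩

/-- The order in which a pseudoline that rotates about `v`, starting from `f`, meets the other
points. -/
def IsBefore (v f r s : P.Point) : Prop :=
  r ≠ s ∧ (r = f ∨ (s ≠ f ∧ ¬ SameSide (P.lineThrough v r) f s))

/-- Both sides say that `b` is between `v` and the point where `P.lineThrough v b` crosses the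
pseudosegment between `a` and `c`. -/
theorem sameSide_iff_not_sameSide (hva : v ≠ a) (hvb : v ≠ b) (hvc : v ≠ c) (hab : a ≠ b)
    (hac : a ≠ c) (hbc : b ≠ c) (h : ¬ SameSide (P.lineThrough v b) a c)
    (h' : SameSide (P.lineThrough v a) b c) :
    SameSide (P.lineThrough a c) v b ↔ ¬ SameSide (P.lineThrough a b) v c := by
  obtain ⟨s, hs, hsb⟩ := exists_mem_seg_of_not_sameSide hac h
  have hsac := seg_subset_lineThrough hs
  have hsa : s ≠ a := ne_of_mem_lineThrough hsb hvb hva.symm hab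
  have hsv : s ≠ v := ne_of_mem_lineThrough hsac hac hva hvc
  have hsb' : s ≠ b := ne_of_mem_lineThrough hsac hac hab.symm hbc
  have hbv : (b : Plane) ≠ v := Subtype.coe_ne_coe.2 hvb.symm
  have hM := isPseudoline_lineThrough hvb
  have hv := left_mem_lineThrough hvb
  have hb := right_mem_lineThrough hvb
  have hv_notMem : (v : Plane) ∉ pseudosegment (P.lineThrough v b) b s := by
    rw [← sameSide_iff_notMem_pseudosegment hvb hva hab.symm hb hsb hbv hsv]
    exact h'.trans (sameSide_of_mem_seg hvc hva hac hs hsa).symm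
  have hsc : SameSide (P.lineThrough a b) s c := by
    rw [lineThrough_comm]
    exact sameSide_of_mem_seg hbc hab.symm hac hs hsa
  rw [← hsc.right_congr, (crossesOnce_of_ne' hvb hac hva hvc).sameSide_iff hM hsac hsb hv hb
    hsv.symm hsb'.symm, lineThrough_comm a b, sameSide_iff_notMem_pseudosegment hvb.symm hab.symm
    hva (right_mem_lineThrough hvb.symm) (lineThrough_comm v b ▸ hsb) hbv.symm hsb', not_not,
    lineThrough_comm b v]
  constructor
  · intro hs_notMem
    rcases hM.mem_pseudosegment_trichotomy hv hb hsb with k | k | k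
    · exact absurd k hv_notMem
    · exact k
    · exact absurd k hs_notMem
  · intro hb_mem hs_mem
    rw [pseudosegment_comm] at hb_mem hs_mem
    exact hsb'.symm (hM.eq_of_mem_pseudosegment hv hb_mem hs_mem)

namespace IsExtremePair

variable (hE : IsExtremePair Finset.univ v f)

include hE

theorem sameSide_of_separated (hva : v ≠ a) (hvb : v ≠ b) (hvc : v ≠ c) (hab : a ≠ b)
    (hac : a ≠ c) (hbc : b ≠ c) (h₁ : ¬ SameSide (P.lineThrough v a) b c) :
    SameSide (P.lineThrough v b) a c := by
  by_contra h₂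
  obtain ⟨hvf, h⟩ := hE
  simp only [Finset.mem_univ, true_imp_iff] at h
  by_cases hfa : a = f
  · exact h₁ (hfa ▸ h b c hvb.symm (hfa ▸ hab.symm) hvc.symm (hfa ▸ hac.symm))
  by_cases hfb : b = f
  · exact h₂ (hfb ▸ h a c hva.symm (hfb ▸ hab) hvc.symm (hfb ▸ hbc.symm))
  by_cases hfc : c = f
  · exact separated_of_separated_of_separated hva hvb hvc hab hac hbc h₁ h₂
      (hfc ▸ h a b hva.symm hfa hvb.symm hfb)
  obtain ⟨s, hs, hsa, hv⟩ := exists_mem_seg_of_separated hva hvb hvc hab hbc h₁ h₂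
  have hsc : SameSide (P.lineThrough v f) s c :=
    (crossesOnce_of_ne hvf hbc hvb hvc).sameSide_of_mem (isPseudoline_lineThrough hbc)
      (h b c hvb.symm hfb hvc.symm hfc) (left_mem_lineThrough hbc) (right_mem_lineThrough hbc)
      hs
  have hcross : CrossesOnce (P.lineThrough v f) (P.lineThrough v a) := by
    rw [lineThrough_comm v f]
    exact crossesOnce_of_ne hvf.symm hva hvf.symm (Ne.symm hfa)
  exact hcross.notMem_of_sameSide (isPseudoline_lineThrough hva)
    ((h a c hva.symm hfa hvc.symm hfc).trans hsc.symm) (right_mem_lineThrough hva) hsa hv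
    (left_mem_lineThrough hvf)

theorem isBefore_total (ha : a ≠ v) (hb : b ≠ v) (h : a ≠ b) :
    IsBefore v f a b ∨ IsBefore v f b a := by
  by_cases hfa : a = f
  · exact .inl ⟨h, .inl hfa⟩
  by_cases hfb : b = f
  · exact .inr ⟨h.symm, .inl hfb⟩
  by_contra! hc
  simp only [IsBefore, h, h.symm, hfa, hfb, ne_eq, not_false_eq_true, true_and, false_or,
    not_not] at hc
  exact not_sameSide_of_sameSide_of_sameSide hE.1 ha.symm hb.symm (Ne.symm hfa) (Ne.symm hfb) h
    (hE.2 a (Finset.mem_univ _) b (Finset.mem_univ _) ha hfa hb hfb) hc.1 hc.2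

theorem isBefore_asymm (ha : a ≠ v) (hb : b ≠ v) (h : IsBefore v f a b) : ¬ IsBefore v f b a := by
  rintro ⟨-, h'⟩
  obtain ⟨hab, rfl | ⟨hbf, h⟩⟩ := h
  · simp [hab.symm] at h'
  obtain rfl | ⟨haf, h'⟩ := h'
  · exact hbf rfl
  · rw [sameSide_comm] at h h'
    exact h' (hE.sameSide_of_separated ha.symm hb.symm hE.1 hab haf hbf h)

theorem separated (ha : a ≠ v) (hb : b ≠ v) (h : IsBefore v f a b) (h' : IsBefore v f b c) :
    ¬ SameSide (P.lineThrough v b) a c := by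
  obtain ⟨hab, rfl | ⟨hbf, h⟩⟩ := h
  · exact (h'.2.resolve_left hab.symm).2
  have hbc := (h'.2.resolve_left hbf).2
  by_cases haf : a = f
  · rwa [haf]
  rw [sameSide_comm] at h
  rwa [(hE.sameSide_of_separated ha.symm hb.symm hE.1 hab haf hbf h).left_congr]

theorem sameSide_left (ha : a ≠ v) (hb : b ≠ v) (hc : c ≠ v) (hac : a ≠ c)
    (h : IsBefore v f a b) (h' : IsBefore v f b c) : SameSide (P.lineThrough v a) b c :=
  hE.sameSide_of_separated hb.symm ha.symm hc.symm h.1.symm h'.1 hac (hE.separated ha hb h h')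

theorem sameSide_right (ha : a ≠ v) (hb : b ≠ v) (hc : c ≠ v) (hac : a ≠ c)
    (h : IsBefore v f a b) (h' : IsBefore v f b c) : SameSide (P.lineThrough v c) a b := by
  have := hE.separated ha hb h h'
  rw [sameSide_comm] at this ⊢
  exact hE.sameSide_of_separated hb.symm hc.symm ha.symm h'.1 h.1.symm hac.symm this

theorem isBefore_trans (ha : a ≠ v) (hb : b ≠ v) (hc : c ≠ v) (h : IsBefore v f a b)
    (h' : IsBefore v f b c) : IsBefore v f a c := by
  have hac : a ≠ c := by
    rintro rfl
    exact hE.isBefore_asymm ha hb h h'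
  refine (hE.isBefore_total ha hc hac).resolve_right fun k => ?_
  exact hE.separated hb hc h' k (hE.sameSide_right ha hb hc hac h h').symm

/-- The points of the configuration other than `v`, in the order in which they are seen from `v`. -/
noncomputable abbrev linearOrder : LinearOrder {p : P.Point // p ≠ v} :=
  haveI : IsStrictTotalOrder {p : P.Point // p ≠ v} fun p q => IsBefore v f p q :=
    { trichotomous := fun p q h h' => by
        by_contra hne
        exact (hE.isBefore_total p.2 q.2 (Subtype.coe_ne_coe.2 hne)).elim h h'
      irrefl := fun p h => h.1 rfl
      trans := fun p q r h h' => hE.isBefore_trans p.2 q.2 r.2 h h' }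
  haveI := Classical.decRel fun p q : {p : P.Point // p ≠ v} => IsBefore v f p q
  linearOrderOfSTO fun p q : {p : P.Point // p ≠ v} => IsBefore v f p q

end IsExtremePair

/-- The orientation of a triple of points, for the order in which they are seen from `v`: three
points `p`, `q`, `r` in this order are clockwise if `r` and `v` are on one side of the pseudoline of
`p` and `q`. -/
def IsClockwise (v f p q r : P.Point) : Prop :=
  IsBefore v f p q ↔ SameSide (P.lineThrough p q) v r

theorem sameSide_iff_isClockwise (ha : a ≠ v) (hb : b ≠ v) (hab : a ≠ b) (hac : a ≠ c)
    (had : a ≠ d) (hbc : b ≠ c) (hbd : b ≠ d) :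
    SameSide (P.lineThrough a b) c d ↔ (IsClockwise v f a b c ↔ IsClockwise v f a b d) := by
  have of_sameSide : SameSide (P.lineThrough a b) v c → SameSide (P.lineThrough a b) v d →
      SameSide (P.lineThrough a b) c d := fun h h' => h.symm.trans h'
  have of_not_sameSide : ¬ SameSide (P.lineThrough a b) v c → ¬ SameSide (P.lineThrough a b) v d →
      SameSide (P.lineThrough a b) c d := fun h h' =>
    sameSide_of_not_sameSide_of_not_sameSide hab hac hbc ha hb had hbd (mt SameSide.symm h) h'
  have right_congr : SameSide (P.lineThrough a b) c d →
      (SameSide (P.lineThrough a b) v c ↔ SameSide (P.lineThrough a b) v d) :=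
    SameSide.right_congr
  unfold IsClockwise
  tauto

namespace IsExtremePair

variable (hE : IsExtremePair Finset.univ v f)

include hE

theorem sameSide_iff_isBefore_iff (hc : c ≠ v) (ha : a ≠ v) (hb : b ≠ v) (hca : c ≠ a)
    (hcb : c ≠ b) (hab : a ≠ b) :
    SameSide (P.lineThrough v c) a b ↔ (IsBefore v f c a ↔ IsBefore v f c b) := by
  wlog h : IsBefore v f a b generalizing a b
  · rw [sameSide_comm, iff_comm (a := IsBefore v f c a)]
    exact this hb ha hcb hca hab.symm ((hE.isBefore_total ha hb hab).resolve_left h)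
  rcases hE.isBefore_total hc ha hca with hca' | hac'
  · exact iff_of_true (hE.sameSide_left hc ha hb hcb hca' h)
      (iff_of_true hca' (hE.isBefore_trans hc ha hb hca' h))
  have hca' := hE.isBefore_asymm ha hc hac'
  rcases hE.isBefore_total hc hb hcb with hcb' | hbc'
  · exact iff_of_false (hE.separated ha hc hac' hcb') fun k => hca' (k.2 hcb')
  · exact iff_of_true (hE.sameSide_right ha hb hc hca.symm h hbc')
      (iff_of_false hca' (hE.isBefore_asymm hb hc hbc'))

theorem isClockwise_swap (ha : a ≠ v) (hb : b ≠ v) (hab : a ≠ b) :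
    IsClockwise v f b a c ↔ ¬ IsClockwise v f a b c := by
  rw [IsClockwise, IsClockwise, lineThrough_comm b a]
  rcases hE.isBefore_total ha hb hab with h | h
  · have := hE.isBefore_asymm ha hb h
    tauto
  · have := hE.isBefore_asymm hb ha h
    tauto

theorem isClockwise_rotate (ha : a ≠ v) (hb : b ≠ v) (hc : c ≠ v) (hab : IsBefore v f a b)
    (hbc : IsBefore v f b c) : (IsClockwise v f a b c ↔ IsClockwise v f b c a) ∧
      (IsClockwise v f b c a ↔ IsClockwise v f c a b) := by
  have hac := hE.isBefore_trans ha hb hc hab hbc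
  have h₁ := sameSide_iff_not_sameSide ha.symm hb.symm hc.symm hab.1 hac.1 hbc.1
    (hE.separated ha hb hab hbc) (hE.sameSide_left ha hb hc hac.1 hab hbc)
  have h₂ := sameSide_iff_not_sameSide hc.symm hb.symm ha.symm hbc.1.symm hac.1.symm hab.1.symm
    (fun k => hE.separated ha hb hab hbc k.symm) (hE.sameSide_right ha hb hc hac.1 hab hbc).symm
  rw [lineThrough_comm c b] at h₂
  simp only [IsClockwise, hab, hbc, hE.isBefore_asymm ha hc hac, true_iff, false_iff,
    lineThrough_comm a c] at h₁ ⊢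
  tauto

theorem isOrientation :
    @IsOrientation _ hE.linearOrder
      fun p q r : {p : P.Point // p ≠ v} => IsClockwise v f p q r := by
  let := hE.linearOrder
  have hne {p q : {p : P.Point // p ≠ v}} : p ≠ q → (p : P.Point) ≠ q := Subtype.coe_ne_coe.2
  refine ⟨fun p q r hpq hqr hpr h => ?_, fun p q r hpq _ _ => ?_, ?_, ?_⟩
  · exact IsOrientation.cyc_of_lt (o := fun p q r : {p : P.Point // p ≠ v} => IsClockwise v f p q r)
      (fun p q r hpq => hE.isClockwise_swap p.2 q.2 (hne hpq))
      (fun p q r => hE.isClockwise_rotate p.2 q.2 r.2) hpq hqr hpr h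
  · exact hE.isClockwise_swap p.2 q.2 (hne hpq)
  · intro c x y z w hcx hcy hcz hcw hxy hxz hxw hyz hyw hzw h h'
    rw [← sameSide_iff_isClockwise c.2 x.2 (hne hcx) (hne hcy) (hne hcz) (hne hxy) (hne hxz)] at h
    rw [← sameSide_iff_isClockwise c.2 w.2 (hne hcw) (hne hcy) (hne hcz) (hne hyw.symm)
      (hne hzw.symm)] at h'
    rw [← sameSide_iff_isClockwise c.2 y.2 (hne hcy) (hne hcx) (hne hcz) (hne hxy.symm) (hne hyz),
      ← sameSide_iff_isClockwise c.2 w.2 (hne hcw) (hne hcx) (hne hcy) (hne hxw.symm)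
      (hne hyw.symm)]
    exact sameSide_exchange (hne hcx) (hne hcy) (hne hcz) (hne hcw) (hne hxy) (hne hxw) (hne hyz)
      h h'
  · intro c x y z hcx hcy hcz hxy hxz hyz h h'
    have h' := (hE.sameSide_iff_isBefore_iff c.2 y.2 z.2 (hne hcy) (hne hcz) (hne hyz)).2 h'
    refine .trans ?_ (hE.sameSide_iff_isBefore_iff c.2 x.2 y.2 (hne hcx) (hne hcy) (hne hxy))
    rw [← sameSide_iff_isClockwise c.2 x.2 (hne hcx) (hne hcy) (hne hcz) (hne hxy) (hne hxz)] at h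
    rw [← sameSide_iff_isClockwise c.2 y.2 (hne hcy) (hne hcx) (hne hcz) (hne hxy.symm) (hne hyz)]
    rw [lineThrough_comm v c] at *
    exact sameSide_exchange (hne hcx) (hne hcy) (hne hcz) c.2 (hne hxy) x.2 (hne hyz) h h'

end IsExtremePair

end PseudoConfiguration

/-- No point of `Q` is inside a triangle of points of `Q`: convex position in terms of the
orientation `o` of triples. -/
def IsConvexSet {α : Type*} (o : α → α → α → Prop) (Q : Finset α) : Prop :=
  ∀ p ∈ Q, ∀ q ∈ Q, ∀ r ∈ Q, ∀ s ∈ Q, p ≠ q → p ≠ r → p ≠ s → q ≠ r → q ≠ s → r ≠ s →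
    ¬ (o p q r ∧ o p r s ∧ o p s q)

theorem exists_forall_rel_of_no_cycle {α : Type*} (R : α → α → Prop) {S : Finset α}
    (hS : S.Nonempty) (htot : ∀ a ∈ S, ∀ b ∈ S, a ≠ b → R a b ∨ R b a)
    (hcyc : ∀ a ∈ S, ∀ b ∈ S, ∀ c ∈ S, a ≠ b → a ≠ c → b ≠ c → R a b → R b c → ¬ R c a) :
    ∃ q ∈ S, ∀ r ∈ S, r ≠ q → R q r := by
  induction hS using Finset.Nonempty.cons_induction with
  | singleton a => exact ⟨a, by simp, by simp⟩
  | cons z S hz _ ih =>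
    simp only [Finset.mem_cons, forall_eq_or_imp] at htot hcyc
    obtain ⟨q, hq, h⟩ := ih (fun a ha => (htot.2 a ha).2)
      (fun a ha b hb => ((hcyc.2 a ha).2 b hb).2)
    have hzq : z ≠ q := ne_of_mem_of_not_mem hq hz |>.symm
    simp only [Finset.mem_cons, exists_eq_or_imp, forall_eq_or_imp]
    by_cases hqz : R q z
    · exact .inr ⟨q, hq, fun _ => hqz, h⟩
    · refine .inl ⟨fun k => (k rfl).elim, fun r hr hrz => ?_⟩
      have hRzq := (htot.1.2 q hq hzq).resolve_right hqz
      rcases eq_or_ne r q with rfl | hrq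
      · exact hRzq
      · exact (htot.1.2 r hr hrz.symm).resolve_right
          ((hcyc.1.2 q hq).2 r hr hzq hrz.symm hrq.symm hRzq (h r hr hrq))

theorem IsConvexSet.exists_tangent {α : Type*} [LinearOrder α] {o : α → α → α → Prop}
    (ho : IsOrientation o) {Q : Finset α} (hQ : IsConvexSet o Q) (hc : 2 ≤ Q.card) {p : α}
    (hp : p ∈ Q) : ∃ q ∈ Q, q ≠ p ∧ ∀ r ∈ Q, r ≠ p → r ≠ q → o p q r := by
  have hne : (Q.erase p).Nonempty := by
    rw [← Finset.card_pos, Finset.card_erase_of_mem hp]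
    omega
  have htot : ∀ a ∈ Q.erase p, ∀ b ∈ Q.erase p, a ≠ b → o p a b ∨ o p b a := fun a ha b hb hab => by
    rw [ho.swap' (Finset.ne_of_mem_erase ha).symm hab (Finset.ne_of_mem_erase hb).symm]
    exact em _
  obtain ⟨q, hq, h⟩ := exists_forall_rel_of_no_cycle (o p) hne htot
    fun a ha b hb c hc hab hac hbc h₁ h₂ h₃ => by
      rw [Finset.mem_erase] at ha hb hc
      exact hQ p hp a ha.2 b hb.2 c hc.2 ha.1.symm hb.1.symm hc.1.symm hab hac hbc ⟨h₁, h₂, h₃⟩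
  rw [Finset.mem_erase] at hq
  exact ⟨q, hq.2, hq.1, fun r hr hrp => h r (Finset.mem_erase.2 ⟨hrp, hr⟩)⟩

theorem IsPseudoline.exists_ray {L : Set Plane} {p q : Plane} (hL : IsPseudoline L) (hp : p ∈ L)
    (hq : q ∈ L) (hpq : p ≠ q) :
    ∃ R ⊆ L, p ∈ R ∧ q ∉ R ∧ IsPreconnected R ∧ ¬ Bornology.IsBounded R := by
  obtain ⟨γ, a, b, hγ, rfl, rfl, hab⟩ := hL.exists_parametrizes_lt hp hq hpq
  refine ⟨γ '' Iic a, ?_, mem_image_of_mem γ (mem_Iic.2 le_rfl), ?_,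
    isPreconnected_Iic.image γ hγ.1.continuousOn, hγ.not_isBounded_image_Iic a⟩
  · rintro _ ⟨t, -, rfl⟩
    exact hγ.mem t
  · rw [hγ.2.1.mem_set_image, mem_Iic]
    exact hab.not_ge

namespace PseudoConfiguration

variable {P : PseudoConfiguration} {p q : P.Point} {x : Plane}

theorem notMem_hull {Q R : Set Plane} (hR : IsPreconnected R) (hbd : ¬ Bornology.IsBounded R)
    (hRQ : R ⊆ (P.skeleton Q)ᶜ) (hx : x ∈ R) : x ∉ P.hull Q := by
  rw [hull, mem_compl_iff, not_not]
  exact ⟨hRQ hx, fun h => hbd (h.subset (hR.subset_connectedComponentIn hx hRQ))⟩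

theorem notMem_skeleton_of_tangent {Q : Set P.Point} (hpq : p ≠ q) (hp : p ∉ Q)
    (h : ∀ r ∈ Q, ∀ s ∈ Q, r ≠ q → s ≠ q → SameSide (P.lineThrough p q) r s)
    (hx : x ∈ P.lineThrough p q) (hxq : x ≠ q) : x ∉ P.skeleton (Subtype.val '' Q) := by
  have ne_p : ∀ r ∈ Q, r ≠ p := fun r hr => ne_of_mem_of_not_mem hr hp
  have notMem_lineThrough_q : ∀ s ∈ Q, s ≠ q → x ∉ P.lineThrough q s := fun s hs hsq hxs =>
    hxq <| (crossesOnce_of_ne' hpq hsq.symm hpq (ne_p s hs).symm).eq_of_mem hxs hx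
      (left_mem_lineThrough hsq.symm) (right_mem_lineThrough hpq)
  rintro (⟨r, hr, rfl⟩ | ⟨_, ⟨r, hr, rfl⟩, _, ⟨s, hs, rfl⟩, hrs, hxrs⟩)
  · exact ((mem_lineThrough hpq).1 hx).elim (ne_p r hr) fun e => hxq (congrArg _ e)
  have hrs : r ≠ s := Subtype.coe_ne_coe.1 hrs
  have hx' : x ∈ P.lineThrough r s := pseudosegment_subset hxrs
  by_cases hrq : r = q
  · exact notMem_lineThrough_q s hs (hrq ▸ hrs.symm) (hrq ▸ hx')
  by_cases hsq : s = q
  · exact notMem_lineThrough_q r hr hrq (lineThrough_comm r q ▸ hsq ▸ hx')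
  exact (crossesOnce_of_ne hpq hrs (ne_p r hr).symm (ne_p s hs).symm).notMem_of_sameSide
    (isPseudoline_lineThrough hrs) (h r hr s hs hrq hsq) (left_mem_lineThrough hrs)
    (right_mem_lineThrough hrs) hxrs hx

theorem inConvexPosition_of_tangent (Q : Finset P.Point)
    (h : ∀ p ∈ Q, ∃ q, q ≠ p ∧ ∀ r ∈ Q, ∀ s ∈ Q, r ≠ p → r ≠ q → s ≠ p → s ≠ q →
      SameSide (P.lineThrough p q) r s) :
    P.InConvexPosition (Q.map (Function.Embedding.subtype _)) := by
  refine ⟨fun p hp => ?_, fun p' hp' => ?_⟩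
  · obtain ⟨p, -, rfl⟩ := Finset.mem_map.1 hp
    exact p.2
  obtain ⟨p, hp, rfl⟩ := Finset.mem_map.1 hp'
  obtain ⟨q, hqp, hpq⟩ := h p hp
  have hQ : ((Q.map (Function.Embedding.subtype _) : Finset Plane) : Set Plane) \ {↑p} =
      Subtype.val '' ((Q : Set P.Point) \ {p}) := by
    rw [image_sdiff Subtype.val_injective, image_singleton, Finset.coe_map]
    rfl
  obtain ⟨R, hRL, hpR, hqR, hR, hbd⟩ := (isPseudoline_lineThrough hqp.symm).exists_ray
    (left_mem_lineThrough hqp.symm) (right_mem_lineThrough hqp.symm)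
    (Subtype.coe_ne_coe.2 hqp.symm)
  rw [Function.Embedding.subtype_apply, hQ]
  exact notMem_hull hR hbd (fun x hx => notMem_skeleton_of_tangent hqp.symm (by simp)
    (fun r hr s hs hrq hsq => hpq r hr.1 s hs.1 hr.2 hrq hs.2 hsq) (hRL hx)
    (ne_of_mem_of_not_mem hx hqR)) hpR

theorem IsExtremePair.inConvexPosition {v f : P.Point} (hE : IsExtremePair Finset.univ v f)
    {Q : Finset {p : P.Point // p ≠ v}} (hc : 2 ≤ Q.card)
    (hQ : IsConvexSet (fun p q r : {p : P.Point // p ≠ v} => IsClockwise v f p q r) Q) :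
    P.InConvexPosition
      ((Q.map (Function.Embedding.subtype _)).map (Function.Embedding.subtype _)) := by
  let := hE.linearOrder
  refine inConvexPosition_of_tangent _ fun p' hp' => ?_
  obtain ⟨p, hp, rfl⟩ := Finset.mem_map.1 hp'
  obtain ⟨q, -, hqp, h⟩ := hQ.exists_tangent hE.isOrientation hc hp
  refine ⟨q, Subtype.coe_ne_coe.2 hqp, fun r' hr' s' hs' hrp hrq hsp hsq => ?_⟩
  obtain ⟨r, hr, rfl⟩ := Finset.mem_map.1 hr'
  obtain ⟨s, hs, rfl⟩ := Finset.mem_map.1 hs'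
  exact (sameSide_iff_isClockwise p.2 q.2 (Subtype.coe_ne_coe.2 hqp.symm) hrp.symm hsp.symm
    hrq.symm hsq.symm).2 (iff_of_true (h r hr (Subtype.coe_ne_coe.1 hrp) (Subtype.coe_ne_coe.1 hrq))
      (h s hs (Subtype.coe_ne_coe.1 hsp) (Subtype.coe_ne_coe.1 hsq)))

theorem exists_isOrientation (P : PseudoConfiguration) (hP : 2 ≤ P.points.card) :
    ∃ (α : Type) (_ : LinearOrder α) (_ : Fintype α) (o : α → α → α → Prop), IsOrientation o ∧
      Fintype.card α + 1 = P.points.card ∧ ∀ Q : Finset α, 2 ≤ Q.card → IsConvexSet o Q →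
        ∃ Q' : Finset Plane, Q'.card = Q.card ∧ P.InConvexPosition Q' := by
  obtain ⟨v, -, f, -, hE⟩ := exists_isExtremePair (P := P) Finset.univ (by simpa using hP)
  refine ⟨{p : P.Point // p ≠ v}, hE.linearOrder, inferInstance, _, hE.isOrientation, ?_,
    fun Q hc hQ => ⟨_, by simp, hE.inConvexPosition hc hQ⟩⟩
  have := Fintype.card_subtype_compl fun p : P.Point => p = v
  simp only [Fintype.card_subtype_eq, Fintype.card_coe] at this
  rw [this]
  omega

end PseudoConfiguration

/-- All triples `p < q < r` of elements of `C` have the color `t`. -/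
def IsMono {α : Type*} [LinearOrder α] (c : α → α → α → Prop) (t : Prop) (C : Finset α) : Prop :=
  ∀ p ∈ C, ∀ q ∈ C, ∀ r ∈ C, p < q → q < r → (c p q r ↔ t)

/-- A 2-coloring of triples for which the cups-caps theorem holds: if `i j k` and `j k l` have the
same color, then `i j l` and `i k l` also have this color. -/
def IsTransitiveColoring {α : Type*} [LinearOrder α] (c : α → α → α → Prop) : Prop :=
  ∀ i j k l, i < j → j < k → k < l → (c i j k ↔ c j k l) →
    (c i j k ↔ c i j l) ∧ (c i j k ↔ c i k l)

section Coloring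

variable {α : Type*} [LinearOrder α] {c : α → α → α → Prop} {t : Prop} {C D S : Finset α}
  {d e f : α}

theorem isMono_of_card_le_two (h : C.card ≤ 2) : IsMono c t C := by
  intro p hp q hq r hr hpq hqr
  have h₁ := Finset.card_le_card
    (Finset.insert_subset hp (Finset.insert_subset hq (Finset.singleton_subset_iff.2 hr)))
  rw [Finset.card_eq_three.2 ⟨p, q, r, hpq.ne, (hpq.trans hqr).ne, hqr.ne, rfl⟩] at h₁
  omega

theorem IsTransitiveColoring.dual (hc : IsTransitiveColoring c) :
    IsTransitiveColoring (α := αᵒᵈ) fun p q r => c r q p := fun i j k l hij hjk hkl h => by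
  obtain ⟨h₁, h₂⟩ := hc l k j i hkl hjk hij h.symm
  exact ⟨h.trans h₂, h.trans h₁⟩

theorem IsMono.insert_max (hc : IsTransitiveColoring c) (hC : IsMono c t C)
    (he : IsGreatest (C : Set α) e) (hd : IsGreatest (↑C ∩ Iio e) d) (hef : e < f)
    (h : c d e f ↔ t) : IsMono c t (insert f C) := by
  have hlt : ∀ x ∈ C, x < f := fun x hx => (he.2 hx).trans_lt hef
  have hqef : ∀ q ∈ C, q < e → (c q e f ↔ t) := by
    intro q hq hqe
    rcases (hd.2 ⟨hq, hqe⟩).eq_or_lt with rfl | hqd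
    · exact h
    · have h₁ := hC q hq d hd.1.1 e he.1 hqd hd.1.2
      exact (hc q d e f hqd hd.1.2 hef (h₁.trans h.symm)).2.symm.trans h₁
  intro p hp q hq r hr hpq hqr
  rcases Finset.mem_insert.1 hr with rfl | hr
  · have hq := (Finset.mem_insert.1 hq).resolve_left hqr.ne
    have hp := (Finset.mem_insert.1 hp).resolve_left (hpq.trans hqr).ne
    rcases (he.2 hq).eq_or_lt with rfl | hqe
    · exact hqef p hp hpq
    · have h₁ := hC p hp q hq e he.1 hpq hqe
      exact (hc p q e r hpq hqe hef (h₁.trans (hqef q hq hqe).symm)).1.symm.trans h₁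
  · have hrf := hlt r hr
    have hq := (Finset.mem_insert.1 hq).resolve_left (hqr.trans hrf).ne
    have hp := (Finset.mem_insert.1 hp).resolve_left (hpq.trans (hqr.trans hrf)).ne
    exact hC p hp q hq r hr hpq hqr

theorem IsMono.insert_min (hc : IsTransitiveColoring c) (hC : IsMono c t C)
    (he : IsLeast (C : Set α) e) (hd : IsLeast (↑C ∩ Ioi e) d) (hfe : f < e)
    (h : c f e d ↔ t) : IsMono c t (insert f C) := by
  have hCd : IsMono (α := αᵒᵈ) (fun p q r => c r q p) t C :=
    fun p hp q hq r hr hpq hqr => hC r hr q hq p hp hqr hpq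
  have := IsMono.insert_max (α := αᵒᵈ) (C := C) (d := d) (e := e) (f := f) hc.dual hCd he hd hfe h
  intro p hp q hq r hr hpq hqr
  exact this r (Finset.mem_insert.2 (Finset.mem_insert.1 hr)) q
    (Finset.mem_insert.2 (Finset.mem_insert.1 hq)) p (Finset.mem_insert.2 (Finset.mem_insert.1 hp))
    hqr hpq

theorem exists_isGreatest_inter_Iio (he : IsGreatest (C : Set α) e) (h : 1 < C.card) :
    ∃ d, IsGreatest (↑C ∩ Iio e) d := by
  obtain ⟨x, hx, hxe⟩ := C.exists_mem_ne h e
  have hne : (C.filter (· < e)).Nonempty :=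
    ⟨x, Finset.mem_filter.2 ⟨hx, (he.2 hx).lt_of_ne hxe⟩⟩
  exact ⟨_, (Finset.coe_filter (· < e) C) ▸ (C.filter (· < e)).isGreatest_max' hne⟩

theorem exists_isLeast_inter_Ioi (he : IsLeast (C : Set α) e) (h : 1 < C.card) :
    ∃ d, IsLeast (↑C ∩ Ioi e) d :=
  exists_isGreatest_inter_Iio (α := αᵒᵈ) (C := C) he h

theorem IsTransitiveColoring.exists_isMono_insert (hc : IsTransitiveColoring c)
    (hC : IsMono c True C) (hD : IsMono c False D) (heC : IsGreatest (C : Set α) e)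
    (heD : IsLeast (D : Set α) e) (hC₁ : 1 < C.card) (hD₁ : 1 < D.card) :
    (∃ f ∈ D, f ∉ C ∧ IsMono c True (insert f C)) ∨
      ∃ d ∈ C, d ∉ D ∧ IsMono c False (insert d D) := by
  obtain ⟨d, hd⟩ := exists_isGreatest_inter_Iio heC hC₁
  obtain ⟨f, hf⟩ := exists_isLeast_inter_Ioi heD hD₁
  by_cases h : c d e f
  · exact .inl ⟨f, hf.1.1, fun k => (heC.2 k).not_gt hf.1.2,
      hC.insert_max hc heC hd hf.1.2 (iff_true_intro h)⟩
  · exact .inr ⟨d, hd.1.1, fun k => (heD.2 k).not_gt hd.1.2,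
      hD.insert_min hc heD hf hd.1.2 (iff_false_intro h)⟩

theorem IsTransitiveColoring.exists_isMono_of_add_lt (hc : IsTransitiveColoring c)
    {k l m m' : ℕ} (hk : 1 < k) (hl : 1 < l)
    (h : ∀ T : Finset α, m < T.card → (∃ C ⊆ T, C.card = k ∧ IsMono c True C) ∨
      ∃ C ⊆ T, C.card = l + 1 ∧ IsMono c False C)
    (h' : ∀ T : Finset α, m' < T.card → (∃ C ⊆ T, C.card = k + 1 ∧ IsMono c True C) ∨
      ∃ C ⊆ T, C.card = l ∧ IsMono c False C) (hS : m + m' < S.card) :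
    (∃ C ⊆ S, C.card = k + 1 ∧ IsMono c True C) ∨
      ∃ C ⊆ S, C.card = l + 1 ∧ IsMono c False C := by
  classical
  let E := S.filter fun x =>
    ∃ C ⊆ S, C.card = k ∧ IsMono c True C ∧ IsGreatest (C : Set α) x
  have hES : E ⊆ S := Finset.filter_subset _ S
  have hcard : m < (S \ E).card ∨ m' < E.card := by
    have := Finset.card_sdiff_add_card_eq_card hES
    omega
  rcases hcard with hSE | hE
  · rcases h _ hSE with ⟨C, hCS, hC, hm⟩ | ⟨C, hCS, hC, hm⟩
    · have hmax := C.isGreatest_max' (Finset.card_pos.1 (by omega))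
      obtain ⟨h₁, h₂⟩ := Finset.mem_sdiff.1 (hCS hmax.1)
      exact (h₂ (Finset.mem_filter.2 ⟨h₁, C, hCS.trans Finset.sdiff_subset, hC, hm, hmax⟩)).elim
    · exact .inr ⟨C, hCS.trans Finset.sdiff_subset, hC, hm⟩
  · rcases h' _ hE with ⟨C, hCS, hC, hm⟩ | ⟨D, hDE, hD, hDm⟩
    · exact .inl ⟨C, hCS.trans hES, hC, hm⟩
    have hmin := D.isLeast_min' (Finset.card_pos.1 (by omega))
    obtain ⟨-, C, hCS, hC, hCm, hmax⟩ := Finset.mem_filter.1 (hDE hmin.1)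
    rcases hc.exists_isMono_insert hCm hDm hmax hmin (by omega) (by omega) with
      ⟨f, hf, hfC, hm⟩ | ⟨d, hd, hdD, hm⟩
    · exact .inl ⟨_, Finset.insert_subset (hES (hDE hf)) hCS,
        by rw [Finset.card_insert_of_notMem hfC, hC], hm⟩
    · exact .inr ⟨_, Finset.insert_subset (hCS hd) (hDE.trans hES),
        by rw [Finset.card_insert_of_notMem hdD, hD], hm⟩

theorem IsTransitiveColoring.exists_isMono (hc : IsTransitiveColoring c) (k l : ℕ)
    (hS : (k + l).choose k < S.card) :
    (∃ C ⊆ S, C.card = k + 2 ∧ IsMono c True C) ∨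
      ∃ C ⊆ S, C.card = l + 2 ∧ IsMono c False C := by
  induction k generalizing l S with
  | zero =>
    rw [Nat.choose_zero_right] at hS
    obtain ⟨C, hCS, hC⟩ := Finset.exists_subset_card_eq (Nat.succ_le_of_lt hS)
    exact .inl ⟨C, hCS, hC, isMono_of_card_le_two hC.le⟩
  | succ k ihk =>
    induction l generalizing S with
    | zero =>
      rw [add_zero, Nat.choose_self] at hS
      obtain ⟨C, hCS, hC⟩ := Finset.exists_subset_card_eq (Nat.succ_le_of_lt hS)
      exact .inr ⟨C, hCS, hC, isMono_of_card_le_two hC.le⟩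
    | succ l ihl =>
      refine hc.exists_isMono_of_add_lt (by omega) (by omega) (fun T => ihk (l + 1)) (fun T => ihl)
        (lt_of_eq_of_lt ?_ hS)
      exact Nat.add_right_comm k 1 l ▸ (Nat.choose_succ_succ' (k + 1 + l) k).symm

end Coloring

/-- The strict order `R` lists the elements of `Q` such that all triples have the same
orientation, as in the list of the vertices of a convex polygon. -/
structure IsPolygonOrder {α : Type*} (o : α → α → α → Prop) (R : α → α → Prop) (Q : Finset α) :
    Prop where
  total : ∀ p ∈ Q, ∀ q ∈ Q, p ≠ q → R p q ∨ R q p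
  trans : ∀ p ∈ Q, ∀ q ∈ Q, ∀ r ∈ Q, R p q → R q r → R p r
  irrefl : ∀ p ∈ Q, ¬ R p p
  orient : ∀ p ∈ Q, ∀ q ∈ Q, ∀ r ∈ Q, R p q → R q r → o p q r

namespace IsOrientation

variable {α : Type*} [LinearOrder α] {o : α → α → α → Prop} (ho : IsOrientation o)
  {a b p q r s : α}

include ho

theorem isTransitiveColoring : IsTransitiveColoring o := fun _ _ _ _ hij hjk hkl h =>
  ⟨ho.iff_of_iff_snd hij hjk hkl h, ho.iff_of_iff_trd hij hjk hkl h⟩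

theorem radial_trans (hba : b ≠ a) (hbp : b ≠ p) (hbq : b ≠ q) (hbr : b ≠ r) (hap : a ≠ p)
    (haq : a ≠ q) (har : a ≠ r) (hpq : p ≠ q) (hpr : p ≠ r) (hqr : q ≠ r)
    (hp : o b a p) (hq : o b a q) (hr : o b a r) (h : o b p q) (h' : o b q r) : o b p r := by
  by_contra hc
  have := ho.swap' hbp hpq hbq
  have := ho.exchange b p q r a hbp hbq hbr hba hpq hpr hap.symm hqr haq.symm har.symm
  grind

/-- In the order in which `b` sees points on one side, the orientation is a transitive coloring. -/
theorem radial_transitive (hbp : b ≠ p) (hbq : b ≠ q) (hbr : b ≠ r) (hbs : b ≠ s) (hpq : p ≠ q)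
    (hpr : p ≠ r) (hps : p ≠ s) (hqr : q ≠ r) (hqs : q ≠ s) (hrs : r ≠ s)
    (h₁ : o b p q) (h₂ : o b p r) (h₃ : o b q r) (h₄ : o b q s) (h₅ : o b r s)
    (h : o p q r ↔ o q r s) : (o p q r ↔ o p q s) ∧ (o p q r ↔ o p r s) := by
  have := ho.rot hpq hqr hpr
  constructor
  · have := ho.exchange q p r s b hpq.symm hqr hqs hbq.symm hpr hps hbp.symm hrs hbr.symm hbs.symm
    have := ho.swap p q r hpq hqr hpr
    have := ho.swap p q s hpq hqs hps
    have := ho.swap b q r hbq hqr hbr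
    have := ho.swap b q s hbq hqs hbs
    have := ho.rot hbq.symm hbp hpq.symm
    grind
  · have := ho.exchange r s q p b hrs hqr.symm hpr.symm hbr.symm hqs.symm hps.symm hbs.symm
      hpq.symm hbq.symm hbp.symm
    have := ho.rot hqr hrs hqs
    have := ho.rot hpr hrs hps
    have := ho.rot hbr.symm hbq hqr.symm
    have := ho.rot hbr.symm hbp hpr.symm
    have := ho.swap q r s hqr hrs hqs
    have := ho.swap q r p hqr hpr.symm hpq.symm
    have := ho.swap b r s hbr hrs hbs
    grind

theorem isConvexSet_of_isPolygonOrder {Q : Finset α} {R : α → α → Prop}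
    (hR : IsPolygonOrder o R Q) : IsConvexSet o Q := by
  have hcyc : ∀ p ∈ Q, ∀ q ∈ Q, ∀ r ∈ Q, p ≠ q → p ≠ r → q ≠ r → o p q r →
      R p q ∧ R q r ∨ R q r ∧ R r p ∨ R r p ∧ R p q := by
    intro p hp q hq r hr hpq hpr hqr ho₁
    have := ho.swap p q r hpq hqr hpr
    have := ho.swap' hpq hqr hpr
    have := ho.rot hpq.symm hpr hqr
    have := ho.rot hqr.symm hpq.symm hpr.symm
    have := hR.total p hp q hq hpq
    have := hR.total p hp r hr hpr
    have := hR.total q hq r hr hqr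
    have := hR.orient q hq p hp r hr
    have := hR.orient p hp r hr q hq
    have := hR.orient r hr q hq p hp
    grind
  intro p hp q hq r hr s hs hpq hpr hps hqr hqs hrs ⟨h₁, h₂, h₃⟩
  have hasymm : ∀ x ∈ Q, R p x → ¬ R x p := fun x hx k k' =>
    hR.irrefl p hp (hR.trans p hp x hx p hp k k')
  have hqrs : R q r → R r s → ¬ R s q := fun k k' k'' =>
    hR.irrefl q hq (hR.trans q hq r hr q hq k (hR.trans r hr s hs q hq k' k''))
  have := hcyc p hp q hq r hr hpq hpr hqr h₁
  have := hcyc p hp r hr s hs hpr hps hrs h₂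
  have := hcyc p hp s hs q hq hps hpq hqs.symm h₃
  have := hasymm q hq
  have := hasymm r hr
  have := hasymm s hs
  grind

theorem isConvexSet_of_neg {Q : Finset α} (h : IsConvexSet (fun p q r => ¬ o p q r) Q) :
    IsConvexSet o Q := by
  intro p hp q hq r hr s hs hpq hpr hps hqr hqs hrs ⟨h₁, h₂, h₃⟩
  exact h p hp q hq s hs r hr hpq hps hpr hqs hqr hrs.symm ⟨(ho.swap' hpq hqs hps).1 h₃,
    (ho.swap' hps hrs.symm hpr).1 h₂, (ho.swap' hpr hqr.symm hpq).1 h₁⟩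

theorem of_not_reverse (hpq : p ≠ q) (hqr : q ≠ r) (hpr : p ≠ r) (h : ¬ o r q p) : o p q r :=
  (ho.rot hpq hqr hpr).2 ((ho.swap r q p hqr.symm hpq.symm hpr.symm).2 h)

theorem isConvexSet_of_isMono_true {Q : Finset α} (h : IsMono o True Q) : IsConvexSet o Q :=
  ho.isConvexSet_of_isPolygonOrder (R := (· < ·))
    { total := fun _ _ _ _ => lt_or_gt_of_ne
      trans := fun _ _ _ _ _ _ => lt_trans
      irrefl := fun p _ => lt_irrefl p
      orient := fun p hp q hq r hr hpq hqr => of_iff_true (h p hp q hq r hr hpq hqr) }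

theorem isConvexSet_of_isMono_false {Q : Finset α} (h : IsMono o False Q) : IsConvexSet o Q :=
  ho.isConvexSet_of_isPolygonOrder (R := (· > ·))
    { total := fun _ _ _ _ => Ne.lt_or_gt ∘ Ne.symm
      trans := fun _ _ _ _ _ _ => gt_trans
      irrefl := fun p _ => lt_irrefl p
      orient := fun p hp q hq r hr hpq hqr => ho.of_not_reverse hpq.ne' hqr.ne' (hqr.trans hpq).ne'
        (not_of_iff_false (h r hr q hq p hp hqr hpq)) }

end IsOrientation

theorem IsConvexSet.subset {α : Type*} {o : α → α → α → Prop} {Q S : Finset α}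
    (h : IsConvexSet o Q) (hS : S ⊆ Q) : IsConvexSet o S :=
  fun p hp q hq r hr s hs => h p (hS hp) q (hS hq) r (hS hr) s (hS hs)

namespace IsOrientation

variable {α : Type*} [LinearOrder α] {o : α → α → α → Prop} (ho : IsOrientation o) {i j k l : α}

include ho

theorem cap_fst (hij : i < j) (hjk : j < k) (hkl : k < l) (h : o i j k) (h' : o i k l) : o i j l :=
  (ho.iff_of_iff_fst hij hjk hkl (iff_of_true h h')).1 h

theorem cap_snd (hij : i < j) (hjk : j < k) (hkl : k < l) (h : o i j k) (h' : o j k l) : o i j l :=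
  (ho.iff_of_iff_snd hij hjk hkl (iff_of_true h h')).1 h

theorem cap_trd (hij : i < j) (hjk : j < k) (hkl : k < l) (h : o i j k) (h' : o j k l) : o i k l :=
  (ho.iff_of_iff_trd hij hjk hkl (iff_of_true h h')).1 h

theorem cap_fth (hij : i < j) (hjk : j < k) (hkl : k < l) (h : o i j l) (h' : o j k l) : o i k l :=
  (ho.iff_of_iff_fth hij hjk hkl (iff_of_true h h')).1 h

end IsOrientation

/-- `z` is in the triangle that is cut off above the edge from `c` to `d` of the cap `a`, `c`, `d`,
`b` by the lines of the adjacent edges. -/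
structure InCell {α : Type*} [LinearOrder α] (o : α → α → α → Prop) (a c d b z : α) : Prop where
  hac : a < c
  hcz : c < z
  hzd : z < d
  hdb : d < b
  left : o a c z
  mid : o c z d
  right : o z d b

/-- `p` is in the triangle `a`, `q`, `b`, where both `a`, `p`, `b` and `a`, `q`, `b` are caps. -/
def InnerTo {α : Type*} (o : α → α → α → Prop) (a b p q : α) : Prop :=
  p ≠ q ∧ o p q b ∧ ¬ o p q a

theorem not_innerTo_self {α : Type*} {o : α → α → α → Prop} {a b : α} (p : α) :
    ¬ InnerTo o a b p p :=
  fun h => h.1 rfl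

namespace InCell

variable {α : Type*} [LinearOrder α] {o : α → α → α → Prop} {a b c d e p q r s z : α}

theorem haz (hp : InCell o a c d b p) : a < p := hp.hac.trans hp.hcz

theorem hzb (hp : InCell o a c d b p) : p < b := hp.hzd.trans hp.hdb

variable (ho : IsOrientation o)

include ho

theorem cap_acd (hp : InCell o a c d b p) : o a c d :=
  ho.cap_snd hp.hac hp.hcz hp.hzd hp.left hp.mid

theorem cap_azd (hp : InCell o a c d b p) : o a p d :=
  ho.cap_trd hp.hac hp.hcz hp.hzd hp.left hp.mid

theorem cap_cdb (hp : InCell o a c d b p) : o c d b :=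
  ho.cap_trd hp.hcz hp.hzd hp.hdb hp.mid hp.right

theorem cap_czb (hp : InCell o a c d b p) : o c p b :=
  ho.cap_snd hp.hcz hp.hzd hp.hdb hp.mid hp.right

theorem cap_azb (hp : InCell o a c d b p) : o a p b :=
  ho.cap_snd hp.haz hp.hzd hp.hdb (hp.cap_azd ho) hp.right

theorem innerTo_iff (hp : InCell o a c d b p) (hq : InCell o a c d b q) :
    InnerTo o a b p q ↔ p ≠ q ∧ o b p q ∧ ¬ o a p q := by
  refine and_congr_right fun hpq => ?_
  rw [← ho.rot hp.haz.ne hpq hq.haz.ne, ho.rot hp.hzb.ne' hpq hq.hzb.ne']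

theorem innerTo_trans (hp : InCell o a c d b p) (hq : InCell o a c d b q)
    (hr : InCell o a c d b r) (h : InnerTo o a b p q) (h' : InnerTo o a b q r) :
    InnerTo o a b p r := by
  rw [hp.innerTo_iff ho hq] at h
  rw [hq.innerTo_iff ho hr] at h'
  rw [hp.innerTo_iff ho hr]
  have hab : a < b := hp.haz.trans hp.hzb
  have hpr : p ≠ r := by
    rintro rfl
    exact (ho.swap' hp.hzb.ne' h.1 hq.hzb.ne').1 h'.2.1 h.2.1
  have hb : ∀ z, InCell o a c d b z → o b a z := fun z hz =>
    (ho.rot hab.ne' hz.haz.ne hz.hzb.ne').2 (hz.cap_azb ho)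
  have ha : ∀ z, InCell o a c d b z → ¬ o a b z := fun z hz h =>
    (ho.swap' hz.haz.ne hz.hzb.ne hab.ne).1 h (hz.cap_azb ho)
  refine ⟨hpr, ?_, ?_⟩
  · exact ho.radial_trans hab.ne' hp.hzb.ne' hq.hzb.ne' hr.hzb.ne' hp.haz.ne hq.haz.ne hr.haz.ne
      h.1 hpr h'.1 (hb p hp) (hb q hq) (hb r hr) h.2.1 h'.2.1
  · exact ho.neg.radial_trans hab.ne hp.haz.ne hq.haz.ne hr.haz.ne hp.hzb.ne' hq.hzb.ne' hr.hzb.ne'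
      h.1 hpr h'.1 (ha p hp) (ha q hq) (ha r hr) h.2.2 h'.2.2

theorem innerTo_transitive (hp : InCell o a c d b p) (hq : InCell o a c d b q)
    (hr : InCell o a c d b r) (hs : InCell o a c d b s) (hpq : InnerTo o a b p q)
    (hqr : InnerTo o a b q r) (hrs : InnerTo o a b r s) (h : o p q r ↔ o q r s) :
    (o p q r ↔ o p q s) ∧ (o p q r ↔ o p r s) := by
  have hpr := hp.innerTo_trans ho hq hr hpq hqr
  have hqs := hq.innerTo_trans ho hr hs hqr hrs
  have hps := (hp.innerTo_trans ho hq hs hpq hqs).1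
  rw [hp.innerTo_iff ho hq] at hpq
  rw [hq.innerTo_iff ho hr] at hqr
  rw [hr.innerTo_iff ho hs] at hrs
  rw [hp.innerTo_iff ho hr] at hpr
  rw [hq.innerTo_iff ho hs] at hqs
  exact ho.radial_transitive hp.hzb.ne' hq.hzb.ne' hr.hzb.ne' hs.hzb.ne' hpq.1 hpr.1 hps hqr.1
    hqs.1 hrs.1 hpq.2.1 hpr.2.1 hqr.2.1 hqs.2.1 hrs.2.1 h

theorem cap_of_not_innerTo (hp : InCell o a c d b p) (hq : InCell o a c d b q) (hpq : p < q)
    (h : ¬ InnerTo o a b p q) (h' : ¬ InnerTo o a b q p) : o a p q ∧ o p q b := by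
  have hap := hp.haz
  have hqb := hq.hzb
  have := hp.cap_azb ho
  have := ho.iff_of_iff_snd hap hpq hqb
  have := ho.swap p q b hpq.ne hqb.ne (hpq.trans hqb).ne
  have := ho.swap p q a hpq.ne (hap.trans hpq).ne' hap.ne'
  have := ho.rot hap.ne hpq.ne (hap.trans hpq).ne
  unfold InnerTo at h h'
  grind

theorem of_innerTo_next (hp : InCell o a c d b p) (hq : InCell o a c d b q)
    (h : InnerTo o a b p q) (hz : InCell o c d b e z) : o p q z := by
  have hqzb : o q z b := ho.cap_fth hq.hzd hz.hcz hz.hzd hq.right hz.mid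
  have hapz : o a p z := ho.cap_fst hp.haz hp.hzd hz.hcz (hp.cap_azd ho)
    (ho.cap_trd hp.hac (hp.hcz.trans hp.hzd) hz.hcz (hp.cap_acd ho) hz.left)
  obtain ⟨hpq, hpqb, hpqa⟩ := h
  have hpz := hp.hzd.trans hz.hcz
  have hqz := hq.hzd.trans hz.hcz
  by_contra hpqz
  rcases lt_or_gt_of_ne hpq with hlt | hlt
  · rw [← ho.rot hp.haz.ne hpq hq.haz.ne] at hpqa
    exact hpqa ((ho.iff_of_iff_snd hp.haz hlt hqz (iff_of_false hpqa hpqz)).2 hapz)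
  · exact (ho.swap p q b hpq hq.hzb.ne hp.hzb.ne).1
      (ho.cap_fst hlt hpz hz.hzd ((ho.swap p q z hpq hqz.ne hpz.ne).2 hpqz) hqzb) hpqb

theorem not_of_innerTo_prev (hp : InCell o a c d b p) (hq : InCell o a c d b q)
    (h : InnerTo o a b p q) (hz : InCell o e a c d z) : ¬ o p q z := by
  have hazq : o a z q := ho.cap_fst hz.hcz hz.hzd hq.hcz hz.mid hq.left
  have hzqb : o z q b := ho.cap_fth hz.hzd hq.hcz hq.hzb
    (ho.cap_snd hz.hzd (hq.hcz.trans hq.hzd) hq.hdb hz.right (hq.cap_cdb ho)) (hq.cap_czb ho)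
  obtain ⟨hpq, hpqb, hpqa⟩ := h
  have hzp := hz.hzd.trans hp.hcz
  have hzq := hz.hzd.trans hq.hcz
  intro hpqz
  rcases lt_or_gt_of_ne hpq with hlt | hlt
  · rw [← ho.rot hzp.ne hpq hzq.ne] at hpqz
    rw [← ho.rot hp.haz.ne hpq hq.haz.ne] at hpqa
    exact hpqa (ho.cap_fth hz.hcz hzp hlt hazq hpqz)
  · have hqpb : ¬ o q p b := (ho.swap p q b hpq hq.hzb.ne hp.hzb.ne).not_left.2 hpqb
    have hzqp : ¬ o z q p := by
      rw [ho.rot hzq.ne hpq.symm hzp.ne]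
      exact (ho.swap p q z hpq hzq.ne' hzp.ne').not_left.2 hpqz
    exact hzqp ((ho.iff_of_iff_snd hzq hlt hp.hzb (iff_of_false hzqp hqpb)).2 hzqb)

end InCell

section Dilworth

variable {α : Type*} {R : α → α → Prop} {T C : Finset α}

theorem exists_forall_rel_of_chain (hirr : ∀ p ∈ T, ¬ R p p)
    (htrans : ∀ p ∈ T, ∀ q ∈ T, ∀ r ∈ T, R p q → R q r → R p r) (hne : C.Nonempty) (hCT : C ⊆ T)
    (hch : ∀ p ∈ C, ∀ q ∈ C, p ≠ q → R p q ∨ R q p) (hC : ∀ p ∈ C, ∃ y ∈ T, R y p) :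
    ∃ y ∈ T, ∀ x ∈ C, R y x := by
  obtain ⟨m, hm, hmin⟩ : ∃ m ∈ C, ∀ x ∈ C, x ≠ m → R m x :=
    exists_forall_rel_of_no_cycle R hne hch fun a ha b hb c hc _ _ _ h₁ h₂ h₃ =>
      hirr a (hCT ha) (htrans a (hCT ha) b (hCT hb) a (hCT ha) h₁
        (htrans b (hCT hb) c (hCT hc) a (hCT ha) h₂ h₃))
  obtain ⟨y, hy, hym⟩ := hC m hm
  refine ⟨y, hy, fun x hx => ?_⟩
  rcases eq_or_ne x m with rfl | hxm
  · exact hym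
  · exact htrans y hy m (hCT hm) x (hCT hx) hym (hmin x hx hxm)

theorem card_le_of_chains_of_antichains (h w : ℕ) (hirr : ∀ p ∈ T, ¬ R p p)
    (htrans : ∀ p ∈ T, ∀ q ∈ T, ∀ r ∈ T, R p q → R q r → R p r)
    (hh : ∀ C ⊆ T, (∀ p ∈ C, ∀ q ∈ C, p ≠ q → R p q ∨ R q p) → C.card ≤ h)
    (hw : ∀ A ⊆ T, (∀ p ∈ A, ∀ q ∈ A, ¬ R p q) → A.card ≤ w) : T.card ≤ h * w := by
  classical
  induction h generalizing T with
  | zero =>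
    suffices T = ∅ by simp [this]
    refine Finset.eq_empty_of_forall_notMem fun x hx => ?_
    simpa using hh {x} (by simpa using hx) (by simp)
  | succ h ih =>
    let M := T.filter fun x => ∀ y ∈ T, ¬ R y x
    have hMT : M ⊆ T := Finset.filter_subset _ _
    have hM : M.card ≤ w := hw M hMT fun p hp q hq => (Finset.mem_filter.1 hq).2 p (hMT hp)
    have hsub : T \ M ⊆ T := Finset.sdiff_subset
    have hTM : (T \ M).card ≤ h * w := by
      refine ih (fun p hp => hirr p (hsub hp))
        (fun p hp q hq r hr => htrans p (hsub hp) q (hsub hq) r (hsub hr)) (fun C hC hch => ?_)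
        fun A hA => hw A (hA.trans hsub)
      rcases C.eq_empty_or_nonempty with rfl | hne
      · simp
      obtain ⟨y, hy, hyx⟩ := exists_forall_rel_of_chain hirr htrans hne (hC.trans hsub) hch
        fun p hp => by
          by_contra! k
          exact (Finset.mem_sdiff.1 (hC hp)).2 (Finset.mem_filter.2 ⟨hsub (hC hp), k⟩)
      have hins := hh (insert y C) (Finset.insert_subset hy (hC.trans hsub)) (by
        simp only [Finset.mem_insert]
        rintro p (rfl | hp) q (rfl | hq) hpq
        · exact (hpq rfl).elim
        · exact .inl (hyx q hq)
        · exact .inr (hyx p hp)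
        · exact hch p hp q hq hpq)
      rw [Finset.card_insert_of_notMem fun k => hirr y hy (hyx y k)] at hins
      omega
    have hcard := Finset.card_sdiff_add_card_eq_card hMT
    linarith [add_mul h 1 w]

end Dilworth

/-- A chain of nested triangles over `a` and `b`, all of whose triples have the orientation `t`. -/
structure IsNestedChain {α : Type*} (o : α → α → α → Prop) (a b : α) (t : Prop) (K : Finset α) :
    Prop where
  total : ∀ p ∈ K, ∀ q ∈ K, p ≠ q → InnerTo o a b p q ∨ InnerTo o a b q p
  color : ∀ p ∈ K, ∀ q ∈ K, ∀ r ∈ K, InnerTo o a b p q → InnerTo o a b q r → (o p q r ↔ t)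

/-- The set `L` forms a cap together with `a` and `b`. -/
structure IsCapOver {α : Type*} [LinearOrder α] (o : α → α → α → Prop) (a b : α) (L : Finset α) :
    Prop where
  mono : IsMono o True L
  ends : ∀ p ∈ L, ∀ q ∈ L, p < q → o a p q ∧ o p q b

theorem isNestedChain_of_subsingleton {α : Type*} {o : α → α → α → Prop} {a b : α} {t : Prop}
    {K : Finset α} (hK : (K : Set α).Subsingleton) : IsNestedChain o a b t K where
  total _ hp _ hq hpq := (hpq (hK hp hq)).elim
  color _ hp _ hq _ _ hpq := (hpq.1 (hK hp hq)).elim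

theorem isCapOver_of_subsingleton {α : Type*} [LinearOrder α] {o : α → α → α → Prop} {a b : α}
    {L : Finset α} (hL : (L : Set α).Subsingleton) : IsCapOver o a b L where
  mono _ hp _ hq _ _ hpq := (hpq.ne (hL hp hq)).elim
  ends _ hp _ hq hpq := (hpq.ne (hL hp hq)).elim

theorem exists_max_card_subset {α : Type*} (T : Finset α) {P : Finset α → Prop}
    (h : ∀ S : Finset α, (S : Set α).Subsingleton → P S) :
    ∃ S ⊆ T, P S ∧ (∀ S' ⊆ T, P S' → S'.card ≤ S.card) ∧ (T.Nonempty → 0 < S.card) := by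
  classical
  obtain ⟨S, hS, hmax⟩ := (T.powerset.filter P).exists_max_image Finset.card
    ⟨∅, Finset.mem_filter.2 ⟨Finset.empty_mem_powerset T, h ∅ (by simp)⟩⟩
  obtain ⟨hST, hPS⟩ := Finset.mem_filter.1 hS
  have hmax' : ∀ S' ⊆ T, P S' → S'.card ≤ S.card := fun S' hS' hP =>
    hmax S' (Finset.mem_filter.2 ⟨Finset.mem_powerset.2 hS', hP⟩)
  refine ⟨S, Finset.mem_powerset.1 hST, hPS, hmax', fun ⟨x, hx⟩ => ?_⟩
  exact hmax' {x} (Finset.singleton_subset_iff.2 hx) (h {x} (by simp))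

section Cell

variable {α : Type*} [LinearOrder α] {o : α → α → α → Prop} (ho : IsOrientation o)
  {a b c d : α}

include ho

theorem IsNestedChain.isPolygonOrder_true {K : Finset α} (h : IsNestedChain o a b True K)
    (hK : ∀ z ∈ K, InCell o a c d b z) : IsPolygonOrder o (InnerTo o a b) K where
  total := h.total
  trans p hp q hq r hr := (hK p hp).innerTo_trans ho (hK q hq) (hK r hr)
  irrefl p _ := not_innerTo_self p
  orient p hp q hq r hr hpq hqr := of_iff_true (h.color p hp q hq r hr hpq hqr)

theorem IsNestedChain.isPolygonOrder_false {K : Finset α} (h : IsNestedChain o a b False K)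
    (hK : ∀ z ∈ K, InCell o a c d b z) : IsPolygonOrder o (Function.swap (InnerTo o a b)) K where
  total p hp q hq hpq := h.total q hq p hp hpq.symm
  trans p hp q hq r hr hqp hrq := (hK r hr).innerTo_trans ho (hK q hq) (hK p hp) hrq hqp
  irrefl p _ := not_innerTo_self p
  orient p hp q hq r hr hqp hrq :=
    have hrp := (hK r hr).innerTo_trans ho (hK q hq) (hK p hp) hrq hqp
    ho.of_not_reverse hqp.1.symm hrq.1.symm hrp.1.symm
      (not_of_iff_false (h.color r hr q hq p hp hrq hqp))

theorem exists_isNestedChain {C : Finset α} (hC : ∀ z ∈ C, InCell o a c d b z)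
    (hch : ∀ p ∈ C, ∀ q ∈ C, p ≠ q → InnerTo o a b p q ∨ InnerTo o a b q p) (k l : ℕ)
    (hcard : (k + l).choose k < C.card) :
    (∃ K ⊆ C, K.card = k + 2 ∧ IsNestedChain o a b True K) ∨
      ∃ K ⊆ C, K.card = l + 2 ∧ IsNestedChain o a b False K := by
  classical
  let R : C → C → Prop := fun p q => InnerTo o a b p q
  have : IsStrictTotalOrder C R :=
    { trichotomous := fun p q h h' => by
        by_contra hne
        exact (hch p p.2 q q.2 fun e => hne (Subtype.ext e)).elim h h'
      irrefl := fun p => not_innerTo_self p.1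
      trans := fun p q r => (hC p p.2).innerTo_trans ho (hC q q.2) (hC r r.2) }
  let := linearOrderOfSTO R
  have htc : IsTransitiveColoring fun p q r : C => o p q r := fun p q r s =>
    (hC p p.2).innerTo_transitive ho (hC q q.2) (hC r r.2) (hC s s.2)
  have hmap : ∀ (t : Prop) (K : Finset C), IsMono (fun p q r : C => o p q r) t K →
      IsNestedChain o a b t (K.map (Function.Embedding.subtype _)) := fun t K hK =>
    { total := fun p hp q hq => hch p (Finset.property_of_mem_map_subtype K hp) q
        (Finset.property_of_mem_map_subtype K hq)
      color := by
        simp only [Finset.forall_mem_map, Function.Embedding.subtype_apply]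
        exact hK }
  have hsub : ∀ K : Finset C, K.map (Function.Embedding.subtype _) ⊆ C :=
    Finset.map_subtype_subset
  refine (htc.exists_isMono k l (S := Finset.univ) (by simpa using hcard)).imp ?_ ?_ <;>
  · rintro ⟨K, -, hK, hm⟩
    exact ⟨_, hsub K, by rw [Finset.card_map, hK], hmap _ K hm⟩

end Cell

theorem IsPolygonOrder.union {α : Type*} [DecidableEq α] {o : α → α → α → Prop}
    {R S : α → α → Prop} {K K' : Finset α} (hK : IsPolygonOrder o R K)
    (hK' : IsPolygonOrder o S K') (hd : Disjoint K K')
    (h : ∀ p ∈ K, ∀ q ∈ K, ∀ r ∈ K', R p q → o p q r)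
    (h' : ∀ p ∈ K, ∀ q ∈ K', ∀ r ∈ K', S q r → o p q r) :
    IsPolygonOrder o
      (fun p q => p ∈ K ∧ q ∈ K ∧ R p q ∨ p ∈ K ∧ q ∈ K' ∨ p ∈ K' ∧ q ∈ K' ∧ S p q) (K ∪ K') := by
  have hnot : ∀ p ∈ K, p ∉ K' := fun _ => (Finset.disjoint_left.1 hd ·)
  refine ⟨fun p _ q _ _ => ?_, fun p _ q _ r _ _ _ => ?_, fun p _ => ?_,
    fun p _ q _ r _ _ _ => ?_⟩
  · have := hK.total p
    have := hK'.total p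
    grind
  · have := hK.trans p
    have := hK'.trans p
    grind
  · have := hK.irrefl p
    have := hK'.irrefl p
    grind
  · have := hK.orient p
    have := hK'.orient p
    grind

section Cell

variable {α : Type*} [LinearOrder α] {o : α → α → α → Prop} (ho : IsOrientation o)
  {a b c d e : α} {n : ℕ}

include ho

theorem IsNestedChain.isConvexSet_union {K K' : Finset α} (hK : ∀ z ∈ K, InCell o a c d b z)
    (hK' : ∀ z ∈ K', InCell o c d b e z) (h : IsNestedChain o a b True K)
    (h' : IsNestedChain o c e False K') : IsConvexSet o (K ∪ K') := by
  have hlt : ∀ p ∈ K, ∀ q ∈ K', p < q := fun p hp q hq => (hK p hp).hzd.trans (hK' q hq).hcz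
  refine ho.isConvexSet_of_isPolygonOrder
    ((h.isPolygonOrder_true ho hK).union (h'.isPolygonOrder_false ho hK') ?_ ?_ ?_)
  · exact Finset.disjoint_left.2 fun p hp hp' => lt_irrefl p (hlt p hp p hp')
  · exact fun p hp q hq z hz hpq => (hK p hp).of_innerTo_next ho (hK q hq) hpq (hK' z hz)
  · intro z hz p hp q hq hqp
    have hnot := (hK' q hq).not_of_innerTo_prev ho (hK' p hp) hqp (hK z hz)
    exact ho.of_not_reverse (hlt z hz p hp).ne hqp.1.symm (hlt z hz q hq).ne hnot

theorem card_chain_le {T C K K' : Finset α} (hT : ∀ z ∈ T, InCell o a c d b z)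
    (hK : ∀ S ⊆ T, IsNestedChain o a b True S → S.card ≤ K.card)
    (hK' : ∀ S ⊆ T, IsNestedChain o a b False S → S.card ≤ K'.card) (hpos : 0 < K.card)
    (hpos' : 0 < K'.card) (hCT : C ⊆ T)
    (hch : ∀ p ∈ C, ∀ q ∈ C, p ≠ q → InnerTo o a b p q ∨ InnerTo o a b q p) :
    C.card ≤ 2 ^ (K.card + K'.card) := by
  by_contra! hlt
  have hchoose : (K.card - 1 + (K'.card - 1)).choose (K.card - 1) < C.card :=
    ((Nat.choose_le_two_pow _ _).trans (Nat.pow_le_pow_right two_pos (by omega))).trans_lt hlt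
  rcases exists_isNestedChain ho (fun z hz => hT z (hCT hz)) hch _ _ hchoose with
    ⟨J, hJ, hJc, hJn⟩ | ⟨J, hJ, hJc, hJn⟩
  · have := hK J (hJ.trans hCT) hJn
    omega
  · have := hK' J (hJ.trans hCT) hJn
    omega

theorem card_antichain_le {T A L : Finset α} (hT : ∀ z ∈ T, InCell o a c d b z)
    (hconv : ∀ Q : Finset α, IsConvexSet o Q → Q.card < n) (hL : IsCapOver o a b L)
    (hmax : ∀ S ⊆ T, IsCapOver o a b S → S.card ≤ L.card) (hpos : 0 < L.card) (hAT : A ⊆ T)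
    (hA : ∀ p ∈ A, ∀ q ∈ A, ¬ InnerTo o a b p q) : A.card ≤ (2 * n) ^ L.card := by
  have hLn : L.card < n := hconv L (ho.isConvexSet_of_isMono_true hL.mono)
  by_contra! hlt
  have hchoose : (L.card - 1 + (n - 2)).choose (L.card - 1) < A.card := by
    refine lt_of_le_of_lt ?_ hlt
    calc (L.card - 1 + (n - 2)).choose (L.card - 1) ≤ (L.card - 1 + (n - 2)) ^ (L.card - 1) :=
          Nat.choose_le_pow _ _
      _ ≤ (2 * n) ^ (L.card - 1) := Nat.pow_le_pow_left (by omega) _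
      _ ≤ (2 * n) ^ L.card := Nat.pow_le_pow_right (by omega) (by omega)
  rcases ho.isTransitiveColoring.exists_isMono _ _ hchoose with
    ⟨J, hJ, hJc, hJm⟩ | ⟨J, -, hJc, hJm⟩
  · have := hmax J (hJ.trans hAT) ⟨hJm, fun p hp q hq hpq =>
      (hT p (hAT (hJ hp))).cap_of_not_innerTo ho (hT q (hAT (hJ hq))) hpq
        (hA p (hJ hp) q (hJ hq)) (hA q (hJ hq) p (hJ hp))⟩
    omega
  · have := hconv J (ho.isConvexSet_of_isMono_false hJm)
    omega

theorem exists_card_cell_le {T : Finset α} (hT : ∀ z ∈ T, InCell o a c d b z)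
    (hconv : ∀ Q : Finset α, IsConvexSet o Q → Q.card < n) :
    ∃ L ⊆ T, ∃ K ⊆ T, ∃ K' ⊆ T, IsCapOver o a b L ∧ IsNestedChain o a b True K ∧
      IsNestedChain o a b False K' ∧ T.card ≤ 2 ^ (K.card + K'.card) * (2 * n) ^ L.card := by
  obtain ⟨L, hLT, hL, hLmax, hLpos⟩ := exists_max_card_subset T (P := IsCapOver o a b)
    fun S => isCapOver_of_subsingleton
  obtain ⟨K, hKT, hK, hKmax, hKpos⟩ := exists_max_card_subset T (P := IsNestedChain o a b True)
    fun S => isNestedChain_of_subsingleton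
  obtain ⟨K', hKT', hK', hKmax', hKpos'⟩ := exists_max_card_subset T
    (P := IsNestedChain o a b False) fun S => isNestedChain_of_subsingleton
  refine ⟨L, hLT, K, hKT, K', hKT', hL, hK, hK', ?_⟩
  rcases T.eq_empty_or_nonempty with rfl | hne
  · simp
  exact card_le_of_chains_of_antichains (R := InnerTo o a b) _ _ (fun p _ => not_innerTo_self p)
    (fun p hp q hq r hr => (hT p hp).innerTo_trans ho (hT q hq) (hT r hr))
    (fun C => card_chain_le ho hT hKmax hKmax' (hKpos hne) (hKpos' hne))
    fun A => card_antichain_le ho hT hconv hL hLmax (hLpos hne)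

end Cell

/-- `y 0, …, y (m - 1)` is an increasing sequence that forms a cap. -/
structure IsCapSeq {α : Type*} [LinearOrder α] (o : α → α → α → Prop) (y : ℕ → α) (m : ℕ) :
    Prop where
  lt : ∀ i j, i < j → j < m → y i < y j
  cap : ∀ i j l, i < j → j < l → l < m → o (y i) (y j) (y l)

/-- `z` is in the cell of the cap `y` above the edge from `y (j + 1)` to `y (j + 2)`. -/
abbrev InCellSeq {α : Type*} [LinearOrder α] (o : α → α → α → Prop) (y : ℕ → α) (j : ℕ) (z : α) :
    Prop :=
  InCell o (y j) (y (j + 1)) (y (j + 2)) (y (j + 3)) z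

theorem sum_range_add_le {k n : ℕ} {x x' : ℕ → ℕ} (hx : ∀ j < k, x j ≤ n) (hx' : ∀ j < k, x' j ≤ n)
    (h : ∀ j, j + 1 < k → x j + x' (j + 1) ≤ n) :
    ∑ j ∈ Finset.range k, (x j + x' j) ≤ (k + 1) * n := by
  rcases k with _ | k
  · simp
  have hstep : ∑ j ∈ Finset.range k, (x j + x' (j + 1)) ≤ k * n := by
    simpa using Finset.sum_le_card_nsmul (Finset.range k) _ n fun j hj =>
      h j (Nat.succ_lt_succ (Finset.mem_range.1 hj))
  rw [Finset.sum_add_distrib] at hstep ⊢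
  rw [Finset.sum_range_succ, Finset.sum_range_succ' x']
  linarith [hx k k.lt_succ_self, hx' 0 k.succ_pos]

section CapSeq

variable {α : Type*} [LinearOrder α] {o : α → α → α → Prop} {y : ℕ → α} {m : ℕ}
  (hy : IsCapSeq o y m)

namespace InCellSeq

variable {i j u v w : ℕ} {p q z : α}

include hy

theorem lt_apply (hz : InCellSeq o y i z) (hv : i + 2 ≤ v) (hvm : v < m) : z < y v := by
  rcases hv.eq_or_lt with rfl | h
  · exact hz.hzd
  · exact hz.hzd.trans (hy.lt _ _ h hvm)

theorem apply_lt (hz : InCellSeq o y i z) (hv : v ≤ i + 1) (hi : i + 1 < m) : y v < z := by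
  rcases hv.eq_or_lt with rfl | h
  · exact hz.hcz
  · exact (hy.lt _ _ h hi).trans hz.hcz

theorem lt_of_lt (hp : InCellSeq o y i p) (hq : InCellSeq o y j q) (hij : i < j)
    (hj : j + 1 < m) : p < q :=
  (lt_apply hy hp (by omega) hj).trans (apply_lt hy hq le_rfl hj)

theorem le_of_lt (hp : InCellSeq o y i p) (hq : InCellSeq o y j q) (hpq : p < q)
    (hi : i + 1 < m) : i ≤ j := by
  by_contra! h
  exact hpq.not_gt (lt_of_lt hy hq hp h hi)

variable (ho : IsOrientation o)

include ho

theorem cap_after (hz : InCellSeq o y i z) (hv : i + 2 ≤ v) (hvw : v < w) (hw : w < m) :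
    o z (y v) (y w) := by
  have hfirst : ∀ w, i + 2 < w → w < m → o z (y (i + 2)) (y w) := by
    intro w hiw hw
    rcases (show i + 3 ≤ w from hiw).eq_or_lt with rfl | h
    · exact hz.right
    · exact ho.cap_snd hz.hzd hz.hdb (hy.lt _ _ h hw) hz.right (hy.cap _ _ _ (by omega) h hw)
  rcases hv.eq_or_lt with rfl | h
  · exact hfirst w hvw hw
  · exact ho.cap_trd hz.hzd (hy.lt _ _ h (by omega)) (hy.lt _ _ hvw hw)
      (hfirst v h (by omega)) (hy.cap _ _ _ h hvw hw)

theorem cap_before (hz : InCellSeq o y i z) (hv : v ≤ i + 1) (huv : u < v) (hi : i + 1 < m) :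
    o (y u) (y v) z := by
  have hlast : ∀ u, u < i + 1 → o (y u) (y (i + 1)) z := by
    intro u hu
    rcases (Nat.lt_succ_iff.1 hu).eq_or_lt with rfl | h
    · exact hz.left
    · exact ho.cap_trd (hy.lt _ _ h (by omega)) hz.hac hz.hcz
        (hy.cap u i (i + 1) h (by omega) hi) hz.left
  rcases hv.eq_or_lt with rfl | h
  · exact hlast u huv
  · exact ho.cap_snd (hy.lt _ _ huv (by omega)) (hy.lt _ _ h hi) hz.hcz
      (hy.cap u v (i + 1) huv h hi) (hlast v h)

theorem cap_between (hp : InCellSeq o y i p) (hq : InCellSeq o y j q) (hij : i + 2 ≤ j)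
    (hj : j + 1 < m) (hv : i + 2 ≤ v) (hvj : v ≤ j + 1) : o p (y v) q := by
  rcases hvj.eq_or_lt with rfl | h
  · exact ho.cap_trd (lt_apply hy hp hij (by omega)) hq.hac hq.hcz
      (cap_after hy ho hp hij (Nat.lt_succ_self j) hj) hq.left
  · exact ho.cap_snd (lt_apply hy hp hv (by omega)) (hy.lt _ _ h hj) hq.hcz
      (cap_after hy ho hp hv h hj) (cap_before hy ho hq le_rfl h hj)

end InCellSeq

variable {k n : ℕ} {I : Finset ℕ} {S T : ℕ → Finset α}

theorem disjoint_of_inCellSeq (hy : IsCapSeq o y m) {i j : ℕ} {C D : Finset α}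
    (hC : ∀ z ∈ C, InCellSeq o y i z) (hD : ∀ z ∈ D, InCellSeq o y j z) (hij : i < j)
    (hj : j + 1 < m) : Disjoint C D :=
  Finset.disjoint_left.2 fun p hp hp' =>
    lt_irrefl p (InCellSeq.lt_of_lt hy (hC p hp) (hD p hp') hij hj)

variable (ho : IsOrientation o)

include ho hy

theorem isMono_biUnion_of_isCapOver (hI : ∀ i ∈ I, ∀ j ∈ I, i < j → i + 2 ≤ j)
    (hIm : ∀ i ∈ I, i + 3 < m) (hS : ∀ i ∈ I, ∀ z ∈ S i, InCellSeq o y i z)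
    (hcap : ∀ i ∈ I, IsCapOver o (y i) (y (i + 3)) (S i)) : IsMono o True (I.biUnion S) := by
  intro p hp q hq r hr hpq hqr
  obtain ⟨i, hi, hp⟩ := Finset.mem_biUnion.1 hp
  obtain ⟨j, hj, hq⟩ := Finset.mem_biUnion.1 hq
  obtain ⟨l, hl, hr⟩ := Finset.mem_biUnion.1 hr
  have him := hIm i hi
  have hjm := hIm j hj
  have hlm := hIm l hl
  have cp := hS i hi p hp
  have cq := hS j hj q hq
  have cr := hS l hl r hr
  refine iff_true_intro ?_
  rcases (InCellSeq.le_of_lt hy cp cq hpq (by omega)).eq_or_lt with rfl | hij <;>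
    rcases (InCellSeq.le_of_lt hy cq cr hqr (by omega)).eq_or_lt with rfl | hjl
  · exact of_iff_true ((hcap i hi).mono p hp q hq r hr hpq hqr)
  · have hil := hI i hi l hl hjl
    exact ho.cap_snd hpq cq.hzb (InCellSeq.apply_lt hy cr (by omega) (by omega))
      ((hcap i hi).ends p hp q hq hpq).2
      (InCellSeq.cap_between hy ho cq cr hil (by omega) (by omega) (by omega))
  · have hij := hI i hi j hj hij
    exact ho.cap_trd (InCellSeq.lt_apply hy cp hij (by omega)) cq.haz hqr
      (InCellSeq.cap_between hy ho cp cq hij (by omega) hij (by omega))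
      ((hcap j hj).ends q hq r hr hqr).1
  · have hij := hI i hi j hj hij
    have hjl := hI j hj l hl hjl
    have hpqy : o p q (y (j + 2)) :=
      ho.cap_trd (InCellSeq.lt_apply hy cp (by omega) (by omega)) cq.hcz cq.hzd
        (InCellSeq.cap_between hy ho cp cq hij (by omega) (by omega) le_rfl) cq.mid
    exact ho.cap_snd hpq cq.hzd (InCellSeq.apply_lt hy cr (by omega) (by omega)) hpqy
      (InCellSeq.cap_between hy ho cq cr hjl (by omega) le_rfl (by omega))

theorem sum_card_lt_of_isCapOver (hconv : ∀ Q : Finset α, IsConvexSet o Q → Q.card < n)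
    (hI : ∀ i ∈ I, ∀ j ∈ I, i < j → i + 2 ≤ j) (hIm : ∀ i ∈ I, i + 3 < m)
    (hS : ∀ i ∈ I, ∀ z ∈ S i, InCellSeq o y i z)
    (hcap : ∀ i ∈ I, IsCapOver o (y i) (y (i + 3)) (S i)) : ∑ i ∈ I, (S i).card < n := by
  have hd : (I : Set ℕ).PairwiseDisjoint S := by
    intro i hi j hj hij
    have := hIm i hi
    have := hIm j hj
    rcases lt_or_gt_of_ne hij with h | h
    · exact disjoint_of_inCellSeq hy (hS i hi) (hS j hj) h (by omega)
    · exact (disjoint_of_inCellSeq hy (hS j hj) (hS i hi) h (by omega)).symm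
  rw [← Finset.card_biUnion hd]
  exact hconv _ (ho.isConvexSet_of_isMono_true (isMono_biUnion_of_isCapOver hy ho hI hIm hS hcap))

theorem sum_range_card_le_of_isCapOver (hm : k + 3 ≤ m)
    (hconv : ∀ Q : Finset α, IsConvexSet o Q → Q.card < n)
    (hS : ∀ i < k, ∀ z ∈ S i, InCellSeq o y i z)
    (hcap : ∀ i < k, IsCapOver o (y i) (y (i + 3)) (S i)) :
    ∑ i ∈ Finset.range k, (S i).card ≤ 2 * n := by
  have hpar : ∀ I ⊆ Finset.range k, (∀ i ∈ I, ∀ j ∈ I, i < j → i + 2 ≤ j) →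
      ∑ i ∈ I, (S i).card ≤ n := fun I hIk hI => by
    have hlt : ∀ i ∈ I, i < k := fun i hi => Finset.mem_range.1 (hIk hi)
    exact (sum_card_lt_of_isCapOver hy ho hconv hI (fun i hi => by have := hlt i hi; omega)
      (fun i hi => hS i (hlt i hi)) fun i hi => hcap i (hlt i hi)).le
  rw [← Finset.sum_filter_add_sum_filter_not (Finset.range k) Even, two_mul]
  refine add_le_add (hpar _ (Finset.filter_subset _ _) ?_) (hpar _ (Finset.filter_subset _ _) ?_)
  all_goals
    simp only [Finset.mem_filter]
    grind

theorem card_add_card_lt_of_isNestedChain {j : ℕ} {K K' : Finset α} (hj : j + 2 < m)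
    (hconv : ∀ Q : Finset α, IsConvexSet o Q → Q.card < n) (hK : ∀ z ∈ K, InCellSeq o y j z)
    (hK' : ∀ z ∈ K', InCellSeq o y (j + 1) z) (h : IsNestedChain o (y j) (y (j + 3)) True K)
    (h' : IsNestedChain o (y (j + 1)) (y (j + 4)) False K') : K.card + K'.card < n := by
  have hd := disjoint_of_inCellSeq hy hK hK' (Nat.lt_succ_self j) hj
  rw [← Finset.card_union_of_disjoint hd]
  exact hconv _ (h.isConvexSet_union ho hK hK' h')

theorem prod_card_cells_le (hm : k + 3 ≤ m)
    (hconv : ∀ Q : Finset α, IsConvexSet o Q → Q.card < n)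
    (hT : ∀ j < k, ∀ z ∈ T j, InCellSeq o y j z) :
    ∏ j ∈ Finset.range k, (T j).card ≤ 2 ^ ((k + 1) * n) * (2 * n) ^ (2 * n) := by
  have hn : 0 < n := (Nat.zero_le _).trans_lt (hconv ∅ (by simp [IsConvexSet]))
  choose! L hL K hK K' hK' hLc hKc hKc' hcard using fun j hj =>
    exists_card_cell_le ho (hT j hj) hconv
  have hKT : ∀ j < k, ∀ z ∈ K j, InCellSeq o y j z := fun j hj z hz => hT j hj z (hK j hj hz)
  have hKT' : ∀ j < k, ∀ z ∈ K' j, InCellSeq o y j z := fun j hj z hz => hT j hj z (hK' j hj hz)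
  have hLsum : ∑ j ∈ Finset.range k, (L j).card ≤ 2 * n :=
    sum_range_card_le_of_isCapOver hy ho hm hconv (fun j hj z hz => hT j hj z (hL j hj hz)) hLc
  have hKsum : ∑ j ∈ Finset.range k, ((K j).card + (K' j).card) ≤ (k + 1) * n :=
    sum_range_add_le
      (fun j hj => (hconv _ (ho.isConvexSet_of_isPolygonOrder
        ((hKc j hj).isPolygonOrder_true ho (hKT j hj)))).le)
      (fun j hj => (hconv _ (ho.isConvexSet_of_isPolygonOrder
        ((hKc' j hj).isPolygonOrder_false ho (hKT' j hj)))).le)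
      fun j hj => (card_add_card_lt_of_isNestedChain hy ho (by omega) hconv (hKT j (by omega))
        (hKT' (j + 1) hj) (hKc j (by omega)) (hKc' (j + 1) hj)).le
  calc ∏ j ∈ Finset.range k, (T j).card
      ≤ ∏ j ∈ Finset.range k, (2 ^ ((K j).card + (K' j).card) * (2 * n) ^ (L j).card) :=
        Finset.prod_le_prod' fun j hj => hcard j (Finset.mem_range.1 hj)
    _ = 2 ^ (∑ j ∈ Finset.range k, ((K j).card + (K' j).card)) *
          (2 * n) ^ (∑ j ∈ Finset.range k, (L j).card) := by
        rw [Finset.prod_mul_distrib, Finset.prod_pow_eq_pow_sum, Finset.prod_pow_eq_pow_sum]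
    _ ≤ 2 ^ ((k + 1) * n) * (2 * n) ^ (2 * n) := by
        gcongr
        · exact one_le_two
        · omega

end CapSeq

section Supersaturation

variable {α : Type*} [Fintype α] {L M : ℕ} {G : Finset (Finset α)}

theorem card_filter_powersetCard_superset_le [DecidableEq α] {S : Finset α} (hS : S.card = L) :
    ((Finset.powersetCard M Finset.univ).filter (S ⊆ ·)).card ≤
      (Fintype.card α - L).choose (M - L) := by
  have hcard : (Finset.powersetCard (M - L) (Finset.univ \ S)).card =
      (Fintype.card α - L).choose (M - L) := by
    rw [Finset.card_powersetCard, Finset.card_sdiff_of_subset (Finset.subset_univ S),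
      Finset.card_univ, hS]
  rw [← hcard]
  refine Finset.card_le_card_of_injOn (fun X => X \ S) (fun X hX => ?_) fun X hX Y hY hXY => ?_
  · obtain ⟨hX, hSX⟩ := Finset.mem_filter.1 hX
    refine Finset.mem_powersetCard.2
      ⟨Finset.sdiff_subset_sdiff (Finset.subset_univ X) subset_rfl, ?_⟩
    rw [Finset.card_sdiff_of_subset hSX, hS, (Finset.mem_powersetCard.1 hX).2]
  · have hSX := (Finset.mem_filter.1 hX).2
    have hSY := (Finset.mem_filter.1 hY).2
    rw [← Finset.sdiff_union_of_subset hSX, ← Finset.sdiff_union_of_subset hSY]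
    exact congrArg (· ∪ S) hXY

theorem choose_le_card_mul_choose (hG : ∀ S ∈ G, S.card = L) (hLM : L ≤ M)
    (hM : M ≤ Fintype.card α) (h : ∀ X : Finset α, X.card = M → ∃ S ∈ G, S ⊆ X) :
    (Fintype.card α).choose L ≤ G.card * M.choose L := by
  classical
  have hcount : (Fintype.card α).choose M ≤ G.card * (Fintype.card α - L).choose (M - L) := by
    have := Finset.card_mul_le_card_mul (s := Finset.powersetCard M (Finset.univ : Finset α))
      (t := G) (fun X S => S ⊆ X) (m := 1)
      (fun X hX => by
        obtain ⟨S, hS, hSX⟩ := h X (Finset.mem_powersetCard.1 hX).2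
        exact Finset.card_pos.2 ⟨S, Finset.mem_filter.2 ⟨hS, hSX⟩⟩)
      fun S hS => card_filter_powersetCard_superset_le (hG S hS)
    rwa [mul_one, Finset.card_powersetCard, Finset.card_univ] at this
  refine Nat.le_of_mul_le_mul_right ?_ (Nat.choose_pos (Nat.sub_le_sub_right hM L))
  calc (Fintype.card α).choose L * (Fintype.card α - L).choose (M - L)
      = (Fintype.card α).choose M * M.choose L := (Nat.choose_mul hLM).symm
    _ ≤ G.card * (Fintype.card α - L).choose (M - L) * M.choose L := by gcongr
    _ = G.card * M.choose L * (Fintype.card α - L).choose (M - L) := by ring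

theorem pow_le_card_mul_pow (hG : ∀ S ∈ G, S.card = L) (hLM : L ≤ M) (hM : M ≤ Fintype.card α)
    (h : ∀ X : Finset α, X.card = M → ∃ S ∈ G, S ⊆ X) :
    (Fintype.card α + 1 - L) ^ L ≤ G.card * M ^ L :=
  calc (Fintype.card α + 1 - L) ^ L ≤ (Fintype.card α).descFactorial L :=
        Nat.pow_sub_le_descFactorial _ L
    _ = L.factorial * (Fintype.card α).choose L := Nat.descFactorial_eq_factorial_mul_choose _ L
    _ ≤ L.factorial * (G.card * M.choose L) := by
        gcongr
        exact choose_le_card_mul_choose hG hLM hM h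
    _ = G.card * M.descFactorial L := by
        rw [Nat.descFactorial_eq_factorial_mul_choose]
        ring
    _ ≤ G.card * M ^ L := by
        gcongr
        exact Nat.descFactorial_le_pow M L

end Supersaturation

/-- The indices `0, 1, 3, 5, …, 2 * k + 1, 2 * k + 2`, for `j = 0, …, k + 2`: in a cap of
`2 * k + 3` points, each omitted point is in a cell of the cap that is formed by the others. -/
def outerIndex (k j : ℕ) : ℕ :=
  min (2 * j - 1) (2 * k + 2)

section OuterIndex

variable {k i j : ℕ}

theorem outerIndex_lt_outerIndex (hij : i < j) (hj : j < k + 3) :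
    outerIndex k i < outerIndex k j := by
  grind [outerIndex]

theorem outerIndex_lt : outerIndex k j < 2 * k + 3 := by
  grind [outerIndex]

theorem exists_outerIndex_or (hi : i < 2 * k + 3) :
    (∃ j < k + 3, outerIndex k j = i) ∨ ∃ j < k, 2 * j + 2 = i := by
  by_cases h : i % 2 = 0 ∧ 2 ≤ i ∧ i ≤ 2 * k
  · exact .inr ⟨(i - 2) / 2, by omega, by omega⟩
  · refine .inl ⟨(i + 1) / 2 + if i = 2 * k + 2 then 1 else 0, ?_, ?_⟩ <;> grind [outerIndex]

variable {α : Type*} [LinearOrder α] {o : α → α → α → Prop} {x : ℕ → α}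

theorem IsCapSeq.comp_outerIndex (hx : IsCapSeq o x (2 * k + 3)) :
    IsCapSeq o (x ∘ outerIndex k) (k + 3) where
  lt _ _ hij hj := hx.lt _ _ (outerIndex_lt_outerIndex hij hj) outerIndex_lt
  cap _ _ _ hij hjl hl := hx.cap _ _ _ (outerIndex_lt_outerIndex hij (hjl.trans hl))
    (outerIndex_lt_outerIndex hjl hl) outerIndex_lt

theorem IsCapSeq.inCellSeq (hx : IsCapSeq o x (2 * k + 3)) (hj : j < k) :
    InCellSeq o (x ∘ outerIndex k) j (x (2 * j + 2)) := by
  have h₀ : outerIndex k j < outerIndex k (j + 1) :=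
    outerIndex_lt_outerIndex j.lt_succ_self (by omega)
  have h₁ : outerIndex k (j + 1) < 2 * j + 2 := by grind [outerIndex]
  have h₂ : 2 * j + 2 < outerIndex k (j + 2) := by grind [outerIndex]
  have h₃ : outerIndex k (j + 2) < outerIndex k (j + 3) :=
    outerIndex_lt_outerIndex (Nat.lt_succ_self _) (by omega)
  exact ⟨hx.lt _ _ h₀ outerIndex_lt, hx.lt _ _ h₁ (by omega), hx.lt _ _ h₂ outerIndex_lt,
    hx.lt _ _ h₃ outerIndex_lt, hx.cap _ _ _ h₀ h₁ (by omega), hx.cap _ _ _ h₁ h₂ outerIndex_lt,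
    hx.cap _ _ _ h₂ h₃ outerIndex_lt⟩

theorem IsMono.exists_isCapSeq {S : Finset α} {m : ℕ} (h : IsMono o True S)
    (hS : S.card = m + 1) :
    ∃ x : ℕ → α, IsCapSeq o x (m + 1) ∧ (Finset.range (m + 1)).image x = S := by
  have hlt : ∀ {i j : ℕ}, i < j → j < m + 1 → (Fin.ofNat (m + 1) i) < Fin.ofNat (m + 1) j := by
    intro i j hij hj
    rw [Fin.lt_def, Fin.val_ofNat, Fin.val_ofNat, Nat.mod_eq_of_lt hj,
      Nat.mod_eq_of_lt (hij.trans hj)]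
    exact hij
  let x : Fin (m + 1) ↪o α := S.orderEmbOfFin hS
  have hmem : ∀ i, x i ∈ S := S.orderEmbOfFin_mem hS
  refine ⟨fun i => x (Fin.ofNat (m + 1) i),
    ⟨fun i j hij hj => x.strictMono (hlt hij hj), fun i j l hij hjl hl => ?_⟩, ?_⟩
  · exact of_iff_true (h _ (hmem _) _ (hmem _) _ (hmem _)
      (x.strictMono (hlt hij (hjl.trans hl))) (x.strictMono (hlt hjl hl)))
  · refine (Finset.image_subset_iff.2 fun i _ => hmem _).antisymm fun p hp => ?_
    rw [← S.image_orderEmbOfFin_univ hS] at hp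
    obtain ⟨i, -, rfl⟩ := Finset.mem_image.1 hp
    refine Finset.mem_image.2 ⟨i, Finset.mem_range.2 i.2, congrArg x ?_⟩
    exact Fin.ofNat_val_eq_self i

end OuterIndex

section Count

variable {α : Type*} [LinearOrder α] {o : α → α → α → Prop} (ho : IsOrientation o)
  {n k : ℕ} {G : Finset (Finset α)}

include ho

theorem card_caps_le_of_outer_eq (hconv : ∀ Q : Finset α, IsConvexSet o Q → Q.card < n)
    {x : Finset α → ℕ → α} (hx : ∀ S ∈ G, IsCapSeq o (x S) (2 * k + 3))
    (himage : ∀ S ∈ G, (Finset.range (2 * k + 3)).image (x S) = S) {y : ℕ → α}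
    (hy : IsCapSeq o y (k + 3)) (hxy : ∀ S ∈ G, ∀ j < k + 3, x S (outerIndex k j) = y j) :
    G.card ≤ 2 ^ ((k + 1) * n) * (2 * n) ^ (2 * n) := by
  classical
  let T : ℕ → Finset α := fun j => G.image fun S => x S (2 * j + 2)
  have hT : ∀ j < k, ∀ z ∈ T j, InCellSeq o y j z := fun j hj z hz => by
    obtain ⟨S, hS, rfl⟩ := Finset.mem_image.1 hz
    simpa only [InCellSeq, Function.comp_apply, hxy S hS j (by omega),
      hxy S hS (j + 1) (by omega), hxy S hS (j + 2) (by omega),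
      hxy S hS (j + 3) (by omega)] using (hx S hS).inCellSeq hj
  refine le_trans ?_ (prod_card_cells_le hy ho le_rfl hconv hT)
  rw [← Fin.prod_univ_eq_prod_range (fun j => (T j).card) k,
    ← Fintype.card_piFinset (fun j : Fin k => T j)]
  refine Finset.card_le_card_of_injOn (fun S (j : Fin k) => x S (2 * j + 2))
    (fun S hS => Fintype.mem_piFinset.2 fun j => Finset.mem_image_of_mem _ hS)
    fun S hS S' hS' hSS' => ?_
  rw [← himage S hS, ← himage S' hS']
  refine Finset.image_congr fun i hi => ?_
  rcases exists_outerIndex_or (Finset.mem_range.1 hi) with ⟨j, hj, rfl⟩ | ⟨j, hj, rfl⟩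
  · exact (hxy S hS j hj).trans (hxy S' hS' j hj).symm
  · exact congrFun hSS' ⟨j, hj⟩

theorem exists_isMono_of_card_eq_four_pow {X : Finset α} {m : ℕ} (hX : X.card = 4 ^ m)
    (hm : 2 ≤ m) : ∃ S ⊆ X, S.card = m ∧ (IsMono o True S ∨ IsMono o False S) := by
  obtain ⟨l, rfl⟩ := Nat.exists_eq_add_of_le' hm
  have hlt : (l + l).choose l < X.card := by
    rw [hX]
    calc (l + l).choose l ≤ 2 ^ (l + l) := Nat.choose_le_two_pow _ _
      _ < 2 ^ (2 * (l + 2)) := Nat.pow_lt_pow_right one_lt_two (by omega)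
      _ = 4 ^ (l + 2) := by
        rw [pow_mul]
        norm_num
  rcases ho.isTransitiveColoring.exists_isMono l l hlt with ⟨S, hS, h, hm⟩ | ⟨S, hS, h, hm⟩
  · exact ⟨S, hS, h, .inl hm⟩
  · exact ⟨S, hS, h, .inr hm⟩

variable [Fintype α]

theorem card_caps_le (hconv : ∀ Q : Finset α, IsConvexSet o Q → Q.card < n)
    (hG : ∀ S ∈ G, S.card = 2 * k + 3 ∧ IsMono o True S) :
    G.card ≤ 2 ^ ((k + 1) * n) * (2 * n) ^ (2 * n) * Fintype.card α ^ (k + 3) := by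
  classical
  rcases G.eq_empty_or_nonempty with rfl | ⟨S₁, hS₁⟩
  · exact Nat.zero_le _
  have : Nonempty (ℕ → α) := ⟨((hG S₁ hS₁).2.exists_isCapSeq (hG S₁ hS₁).1).choose⟩
  choose! x hx himage using fun S hS => (hG S hS).2.exists_isCapSeq (hG S hS).1
  have hcount := Finset.card_le_mul_card_image_of_maps_to (s := G)
    (t := (Finset.univ : Finset (Fin (k + 3) → α)))
    (f := fun S (j : Fin (k + 3)) => x S (outerIndex k j)) (fun _ _ => Finset.mem_univ _)
    (2 ^ ((k + 1) * n) * (2 * n) ^ (2 * n)) fun u _ => ?_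
  · rwa [Finset.card_univ, Fintype.card_fun, Fintype.card_fin] at hcount
  rcases (G.filter fun S => (fun j : Fin (k + 3) => x S (outerIndex k j)) = u).eq_empty_or_nonempty
    with hempty | ⟨S₀, hmem⟩
  · rw [hempty]
    exact Nat.zero_le _
  obtain ⟨hS₀, rfl⟩ := Finset.mem_filter.1 hmem
  exact card_caps_le_of_outer_eq ho hconv (fun S hS => hx S (Finset.filter_subset _ _ hS))
    (fun S hS => himage S (Finset.filter_subset _ _ hS)) (hx S₀ hS₀).comp_outerIndex
    fun S hS j hj => congrFun (Finset.mem_filter.1 hS).2 ⟨j, hj⟩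

theorem card_sub_pow_le (hconv : ∀ Q : Finset α, IsConvexSet o Q → Q.card < n)
    (hN : 4 ^ (2 * k + 3) ≤ Fintype.card α) :
    (Fintype.card α + 1 - (2 * k + 3)) ^ (2 * k + 3) ≤
      2 * (2 ^ ((k + 1) * n) * (2 * n) ^ (2 * n) * Fintype.card α ^ (k + 3)) *
        (4 ^ (2 * k + 3)) ^ (2 * k + 3) := by
  classical
  let G (t : Prop) : Finset (Finset α) :=
    (Finset.powersetCard (2 * k + 3) Finset.univ).filter (IsMono o t)
  have hG : ∀ t, ∀ S ∈ G t, S.card = 2 * k + 3 ∧ IsMono o t S := fun t S hS =>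
    (Finset.mem_filter.1 hS).imp_left fun h => (Finset.mem_powersetCard.1 h).2
  have htrue := card_caps_le ho hconv (hG True)
  have hfalse := card_caps_le ho.neg (fun Q h => hconv Q (ho.isConvexSet_of_neg h)) fun S hS =>
    (hG False S hS).imp_right fun h p hp q hq r hr hpq hqr =>
      iff_true_intro (not_of_iff_false (h p hp q hq r hr hpq hqr))
  have hL : 2 * k + 3 ≤ 4 ^ (2 * k + 3) := (Nat.lt_pow_self (by norm_num)).le
  refine (pow_le_card_mul_pow (G := G True ∪ G False) ?_ hL hN fun X hX => ?_).trans ?_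
  · exact fun S hS => (Finset.mem_union.1 hS).elim (fun h => (hG True S h).1)
      fun h => (hG False S h).1
  · obtain ⟨S, hSX, hS, hm⟩ := exists_isMono_of_card_eq_four_pow ho hX (by omega)
    have hS' : S ∈ Finset.powersetCard (2 * k + 3) Finset.univ :=
      Finset.mem_powersetCard.2 ⟨Finset.subset_univ S, hS⟩
    exact ⟨S, Finset.mem_union.2 (hm.imp (fun h => Finset.mem_filter.2 ⟨hS', h⟩)
      fun h => Finset.mem_filter.2 ⟨hS', h⟩), hSX⟩
  · refine Nat.mul_le_mul_right _ ((Finset.card_union_le _ _).trans ?_)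
    linarith

theorem card_pow_le (hconv : ∀ Q : Finset α, IsConvexSet o Q → Q.card < n)
    (hN : 4 ^ (2 * k + 3) ≤ Fintype.card α) :
    Fintype.card α ^ k ≤
      2 ^ (k * n + n + (2 * k + 3) + 1 + 2 * (2 * k + 3) ^ 2) * (2 * n) ^ (2 * n) := by
  have hfour : ∀ l, 4 ^ l = 2 ^ (2 * l) := fun l => by
    rw [pow_mul]
    norm_num
  have hcaps := card_sub_pow_le ho hconv hN
  set A := Fintype.card α
  set L := 2 * k + 3
  have hLA : 2 * L ≤ A :=
    calc 2 * L ≤ 2 * 2 ^ L := by gcongr; exact Nat.lt_two_pow_self.le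
      _ = 2 ^ (L + 1) := by ring
      _ ≤ 2 ^ (2 * L) := Nat.pow_le_pow_right two_pos (by omega)
      _ = 4 ^ L := (hfour L).symm
      _ ≤ A := hN
  have hhalf : A ^ L ≤ 2 ^ L * (A + 1 - L) ^ L := by
    rw [← mul_pow]
    exact Nat.pow_le_pow_left (by omega) L
  have hA : 0 < A := by omega
  refine Nat.le_of_mul_le_mul_right (c := A ^ (k + 3)) ?_ (by positivity)
  calc A ^ k * A ^ (k + 3) = A ^ L := by
        rw [← pow_add]
        congr 1
        omega
    _ ≤ 2 ^ L * (2 * (2 ^ ((k + 1) * n) * (2 * n) ^ (2 * n) * A ^ (k + 3)) * (4 ^ L) ^ L) :=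
      hhalf.trans (Nat.mul_le_mul_left _ hcaps)
    _ = _ := by
      rw [hfour, ← pow_mul]
      ring

end Count

theorem one_le_log_natCast {n : ℕ} (hn : 3 ≤ n) : 1 ≤ Real.log n := by
  have hn' : (3 : ℝ) ≤ n := by exact_mod_cast hn
  rw [Real.le_log_iff_exp_le (by linarith)]
  linarith [Real.exp_one_lt_d9]

theorem log_le_of_pow_le {n k A : ℕ} {s : ℝ} (hA : 0 < A) (hn : 0 < n) (hs : 1 ≤ s)
    (hsk : s ≤ k) (hks : k ≤ 2 * s) (hns : n ≤ s ^ 2) (hlog : n * Real.log n = s ^ 2)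
    (h : A ^ k ≤
      2 ^ (k * n + n + (2 * k + 3) + 1 + 2 * (2 * k + 3) ^ 2) * (2 * n) ^ (2 * n)) :
    Real.log A ≤ (n + 77 * s) * Real.log 2 := by
  have hlog_pow : (k : ℝ) * Real.log A ≤
      (k * n + n + (2 * k + 3) + 1 + 2 * (2 * k + 3) ^ 2) * Real.log 2 +
        2 * n * (Real.log 2 + Real.log n) := by
    have hcast : (A : ℝ) ^ k ≤
        2 ^ (k * n + n + (2 * k + 3) + 1 + 2 * (2 * k + 3) ^ 2) * (2 * n) ^ (2 * n) := by
      exact_mod_cast h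
    have hle := Real.log_le_log (by positivity) hcast
    rw [Real.log_mul (by positivity) (by positivity), Real.log_pow, Real.log_pow, Real.log_pow,
      Real.log_mul (by norm_num) (by positivity)] at hle
    exact_mod_cast hle
  have hlog_two := Real.log_two_gt_d9
  have hsq : s ^ 2 ≤ k * s := by nlinarith
  have hlog_n : 2 * n * Real.log n ≤ 4 * (k * s) * Real.log 2 := by
    calc 2 * n * Real.log n = 2 * s ^ 2 := by rw [← hlog]; ring
      _ ≤ 4 * (k * s) * Real.log 2 := by nlinarith
  have hexponent :
      (n + (2 * k + 3) + 1 + 2 * (2 * k + 3) ^ 2 + 2 * n : ℝ) ≤ 73 * (k * s) := by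
    nlinarith
  have hexponent_mul :=
    mul_le_mul_of_nonneg_right hexponent (show 0 ≤ Real.log 2 by linarith)
  refine le_of_mul_le_mul_left (hlog_pow.trans ?_) (show (0 : ℝ) < k by linarith)
  linarith

theorem IsOrientation.card_add_two_le {α : Type*} [LinearOrder α] [Fintype α]
    {o : α → α → α → Prop} (ho : IsOrientation o) {n : ℕ} (hn : 3 ≤ n)
    (hconv : ∀ Q : Finset α, IsConvexSet o Q → Q.card < n) :
    (Fintype.card α + 2 : ℝ) ≤ 2 ^ ((n : ℝ) + 100 * √(n * Real.log n)) := by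
  have hn' : (3 : ℝ) ≤ n := by exact_mod_cast hn
  have hlog := one_le_log_natCast hn
  have hsq : √(n * Real.log n) ^ 2 = n * Real.log n := Real.sq_sqrt (by positivity)
  set s := √(n * Real.log n)
  have hns : (n : ℝ) ≤ s ^ 2 := by nlinarith
  have hs : 1 ≤ s := Real.one_le_sqrt.2 (by nlinarith)
  have hsk : s ≤ ⌈s⌉₊ := Nat.le_ceil s
  have hks : (⌈s⌉₊ : ℝ) ≤ s + 1 := (Nat.ceil_lt_add_one (by linarith)).le
  generalize ⌈s⌉₊ = k at hsk hks
  rcases le_or_gt (4 ^ (2 * k + 3)) (Fintype.card α) with hcard | hcard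
  · have hfour : 4 ≤ Fintype.card α := (Nat.le_self_pow (by omega) 4).trans hcard
    have hfour' : (4 : ℝ) ≤ Fintype.card α := by exact_mod_cast hfour
    have hlog_card := log_le_of_pow_le (by omega) (by omega) hs hsk (by linarith) hns hsq.symm
      (card_pow_le ho hconv hcard)
    have hlog_two := Real.log_two_gt_d9
    rw [Real.rpow_def_of_pos two_pos, mul_comm, ← Real.log_le_iff_le_exp (by positivity)]
    calc Real.log (Fintype.card α + 2) ≤ Real.log (2 * Fintype.card α) :=
          Real.log_le_log (by positivity) (by linarith)
      _ = Real.log 2 + Real.log (Fintype.card α) :=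
          Real.log_mul two_ne_zero (by positivity)
      _ ≤ (n + 100 * s) * Real.log 2 := by nlinarith
  · have hpow : Fintype.card α + 2 ≤ 2 ^ (2 * (2 * k + 3) + 1) := by
      have hpos : 1 ≤ 4 ^ (2 * k + 3) := Nat.one_le_pow _ _ four_pos
      rw [pow_succ, pow_mul]
      norm_num
      omega
    calc (Fintype.card α + 2 : ℝ) ≤ 2 ^ (2 * (2 * k + 3) + 1) := by exact_mod_cast hpow
      _ = (2 : ℝ) ^ ((2 * (2 * k + 3) + 1 : ℕ) : ℝ) := (Real.rpow_natCast _ _).symm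
      _ ≤ 2 ^ (n + 100 * s) := by
        refine Real.rpow_le_rpow_of_exponent_le one_le_two ?_
        push_cast
        linarith

theorem pseudoESProperty_floor {n : ℕ} (hn : 3 ≤ n) :
    PseudoESProperty n ⌊(2 : ℝ) ^ ((n : ℝ) + 100 * √(n * Real.log n))⌋₊ := by
  intro P hP
  have htwo : 2 ≤ P.points.card := by
    refine (Nat.le_floor ?_).trans hP
    calc ((2 : ℕ) : ℝ) = 2 ^ (1 : ℝ) := by norm_num
      _ ≤ _ := Real.rpow_le_rpow_of_exponent_le one_le_two <|
        le_add_of_le_of_nonneg (by exact_mod_cast hn.trans' (by norm_num)) (by positivity)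
  obtain ⟨α, _, _, o, ho, hcard, hconvex⟩ := P.exists_isOrientation htwo
  by_contra! hP'
  have hconv : ∀ Q : Finset α, IsConvexSet o Q → Q.card < n := by
    intro Q hQ
    by_contra! hnQ
    obtain ⟨Q₀, hQ₀, hcard₀⟩ := Finset.exists_subset_card_eq hnQ
    obtain ⟨Q', hQ', hpos⟩ := hconvex Q₀ (by omega) (hQ.subset hQ₀)
    exact hP' Q' (hQ'.trans hcard₀) hpos
  have hle := Nat.le_floor (a := (2 : ℝ) ^ ((n : ℝ) + 100 * √(n * Real.log n)))
    (n := Fintype.card α + 2) (by exact_mod_cast ho.card_add_two_le hn hconv)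
  omega

theorem Parametrizes.crossesOnce_setOf_eq_zero {f : Plane → ℝ} {γ : ℝ → Plane} {M : Set Plane}
    (hγ : Parametrizes γ M) (hf : Continuous f)
    (hmono : StrictMono (f ∘ γ) ∨ StrictAnti (f ∘ γ)) {t₀ : ℝ} (ht₀ : f (γ t₀) = 0) :
    CrossesOnce {x | f x = 0} M := by
  have hinj : Function.Injective (f ∘ γ) :=
    hmono.elim (fun h => h.injective) fun h => h.injective
  have hne : ∀ t, γ t ≠ γ t₀ → γ t ∈ {x | f x = 0}ᶜ := fun t ht h =>
    ht (congrArg γ (hinj (h.trans ht₀.symm)))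
  refine ⟨γ t₀, subset_antisymm ?_ (singleton_subset_iff.2 ⟨ht₀, hγ.mem t₀⟩), ?_⟩
  · rintro x ⟨hx, hxM⟩
    obtain ⟨t, rfl⟩ := hγ.exists_eq hxM
    exact congrArg γ (hinj (Eq.trans hx ht₀.symm))
  intro y hy z hz hyx hzx hx heq
  obtain ⟨s, rfl⟩ := hγ.exists_eq hy
  obtain ⟨t, rfl⟩ := hγ.exists_eq hz
  rw [hγ.pseudosegment_eq_image] at hx
  obtain ⟨u, hu, hut⟩ := hx
  obtain rfl : u = t₀ := hγ.2.1 hut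
  have hmaps : MapsTo (f ∘ γ) (uIcc s t) (uIcc (f (γ s)) (f (γ t))) :=
    hmono.elim (fun h => h.monotone.mapsTo_uIcc) fun h => h.antitone.mapsTo_uIcc
  have hs := mem_connectedComponentIn (hne s hyx)
  have ht := mem_connectedComponentIn (hne t hzx)
  rw [← heq] at ht
  have hconn : IsPreconnected (f '' connectedComponentIn {x | f x = 0}ᶜ (γ s)) :=
    isPreconnected_connectedComponentIn.image f hf.continuousOn
  obtain ⟨w, hw, hw₀⟩ := hconn.ordConnected.uIcc_subset (mem_image_of_mem f hs)
    (mem_image_of_mem f ht) (hmaps hu)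
  exact connectedComponentIn_subset _ _ hw (hw₀.trans ht₀)

/-- Twice the signed area of the triangle `p`, `q`, `r`. -/
def area (p q r : Plane) : ℝ :=
  (q 0 - p 0) * (r 1 - p 1) - (q 1 - p 1) * (r 0 - p 0)

/-- The straight line through two distinct points `p` and `q`, as the zero set of the area; for
`p = q` this is the whole plane. -/
def straightLine (p q : Plane) : Set Plane :=
  {x | area p q x = 0}

section Area

variable {a b c d p q r x : Plane}

theorem plane_ext (h₀ : p 0 = q 0) (h₁ : p 1 = q 1) : p = q := by
  ext i
  fin_cases i <;> assumption

theorem area_self_left : area p q p = 0 := by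
  simp [area]

theorem area_self_right : area p q q = 0 := by
  simp only [area]
  ring

theorem straightLine_comm (p q : Plane) : straightLine p q = straightLine q p := by
  ext x
  simp only [straightLine, mem_ofPred_eq, area]
  constructor <;> intro h <;> linear_combination -h

theorem continuous_area (p q : Plane) : Continuous (area p q) := by
  unfold area
  fun_prop

theorem area_lineMap (a b c d : Plane) (t : ℝ) :
    area a b (AffineMap.lineMap c d t) = area a b c + t * (area a b d - area a b c) := by
  simp only [area, AffineMap.lineMap_apply, vsub_eq_sub, vadd_eq_add, PiLp.add_apply,
    PiLp.smul_apply, PiLp.sub_apply, smul_eq_mul]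
  ring

theorem exists_lineMap_eq_of_area_eq_zero (hpq : p ≠ q) (h : area p q x = 0) :
    ∃ t : ℝ, AffineMap.lineMap p q t = x := by
  have hne : (q 0 - p 0) ^ 2 + (q 1 - p 1) ^ 2 ≠ 0 := by
    contrapose! hpq
    have h₀ : q 0 - p 0 = 0 := by nlinarith [sq_nonneg (q 0 - p 0), sq_nonneg (q 1 - p 1)]
    have h₁ : q 1 - p 1 = 0 := by nlinarith [sq_nonneg (q 0 - p 0), sq_nonneg (q 1 - p 1)]
    exact plane_ext (by linarith) (by linarith)
  unfold area at h
  refine ⟨((x 0 - p 0) * (q 0 - p 0) + (x 1 - p 1) * (q 1 - p 1)) /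
    ((q 0 - p 0) ^ 2 + (q 1 - p 1) ^ 2), plane_ext ?_ ?_⟩ <;>
  simp only [AffineMap.lineMap_apply, vsub_eq_sub, vadd_eq_add, PiLp.add_apply, PiLp.smul_apply,
    PiLp.sub_apply, smul_eq_mul] <;>
  field_simp
  · linear_combination (q 1 - p 1) * h
  · linear_combination (-(q 0 - p 0)) * h

theorem collinear_of_area_eq_zero (hpq : p ≠ q) (h : area p q r = 0) :
    Collinear ℝ {p, q, r} := by
  obtain ⟨t, rfl⟩ := exists_lineMap_eq_of_area_eq_zero hpq h
  rw [pair_comm, insert_comm]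
  exact collinear_insert_of_mem_affineSpan_pair (AffineMap.lineMap_mem_affineSpan_pair t p q)

theorem parametrizes_straightLine (hpq : p ≠ q) :
    Parametrizes (fun t : ℝ => AffineMap.lineMap p q t) (straightLine p q) := by
  refine ⟨AffineMap.lineMap_continuous, AffineMap.lineMap_injective ℝ hpq, ?_, ?_⟩
  · rw [← Metric.cobounded_eq_cocompact, ← Metric.cobounded_eq_cocompact]
    have hd : 0 < dist p q := dist_pos.2 hpq
    refine (AntilipschitzWith.of_le_mul_dist (K := ⟨(dist p q)⁻¹, by positivity⟩)
      fun s t => ?_).tendsto_cobounded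
    rw [dist_lineMap_lineMap]
    change dist s t ≤ (dist p q)⁻¹ * (dist s t * dist p q)
    field_simp
    exact le_rfl
  · refine Subset.antisymm (range_subset_iff.2 fun t => ?_) fun x hx =>
      exists_lineMap_eq_of_area_eq_zero hpq hx
    change area p q _ = 0
    rw [area_lineMap, area_self_left, area_self_right]
    ring

theorem segment_subset_pseudosegment (hpq : p ≠ q) :
    segment ℝ p q ⊆ pseudosegment (straightLine p q) p q := by
  rw [segment_eq_image_lineMap]
  rintro _ ⟨t, ht, rfl⟩
  exact ⟨_, parametrizes_straightLine hpq, 0, 1, t, AffineMap.lineMap_apply_zero _ _,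
    AffineMap.lineMap_apply_one _ _, Icc_subset_uIcc ht, rfl⟩

theorem crossesOnce_straightLine (hcd : c ≠ d) (h : area a b c ≠ area a b d) :
    CrossesOnce (straightLine a b) (straightLine c d) := by
  have hslope : area a b d - area a b c ≠ 0 := sub_ne_zero.2 h.symm
  refine (parametrizes_straightLine hcd).crossesOnce_setOf_eq_zero (continuous_area a b)
    (t₀ := -area a b c / (area a b d - area a b c)) ?_ ?_
  · refine (lt_or_gt_of_ne hslope).symm.imp (fun hpos s t hst => ?_) fun hneg s t hst => ?_
    all_goals
      simp only [Function.comp_apply, area_lineMap]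
      nlinarith
  · rw [area_lineMap, div_mul_cancel₀ _ hslope, add_neg_cancel]

end Area

/-- The lines through different pairs of points of `P` are neither equal nor parallel: the area
of `a`, `b`, `x` takes different values at `x = c` and `x = d`. Also for pairs with a common
point, in which case this says that no three points of `P` are collinear. -/
def HasTransverseLines (P : Set Plane) : Prop :=
  ∀ a ∈ P, ∀ b ∈ P, ∀ c ∈ P, ∀ d ∈ P, a ≠ b → c ≠ d → s(a, b) ≠ s(c, d) →
    area a b c ≠ area a b d

theorem HasTransverseLines.straightLine_inter {P : Set Plane} (hP : HasTransverseLines P)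
    {p q : Plane} (hp : p ∈ P) (hq : q ∈ P) (hpq : p ≠ q) : straightLine p q ∩ P = {p, q} := by
  refine Subset.antisymm ?_ ?_
  · rintro x ⟨hx, hxP⟩
    by_contra! h
    obtain ⟨hxp, hxq⟩ := not_or.1 h
    exact hP p hp q hq p hp x hxP hpq (Ne.symm hxp)
      (fun e => hxq (Sym2.congr_right.1 e).symm) (area_self_left.trans (Eq.symm hx))
  · rintro x (rfl | rfl)
    · exact ⟨area_self_left, hp⟩
    · exact ⟨area_self_right, hq⟩

/-- A finite set of points with transverse connecting lines, as a pseudo-configuration. -/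
noncomputable def straightConfiguration (P : Finset Plane)
    (hP : HasTransverseLines (P : Set Plane)) : PseudoConfiguration where
  points := P
  line := straightLine
  line_comm p _ q _ _ := straightLine_comm p q
  line_inter p hp q hq hpq := hP.straightLine_inter hp hq hpq
  arrangement := by
    constructor
    · rintro _ ⟨p, -, q, -, hpq, rfl⟩
      exact ⟨_, parametrizes_straightLine hpq⟩
    · rintro _ ⟨a, ha, b, hb, hab, rfl⟩ _ ⟨c, hc, d, hd, hcd, rfl⟩ hne
      refine crossesOnce_straightLine hcd (hP a ha b hb c hc d hd hab hcd fun e => hne ?_)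
      rcases Sym2.eq_iff.1 e with ⟨rfl, rfl⟩ | ⟨rfl, rfl⟩
      · rfl
      · exact straightLine_comm a b

theorem exists_card_le_finrank_of_notMem_interior_convexHull {E : Type*}
    [NormedAddCommGroup E] [NormedSpace ℝ E] [FiniteDimensional ℝ E] {S : Set E} {x : E}
    (hx : x ∈ convexHull ℝ S) (hint : x ∉ interior (convexHull ℝ S)) :
    ∃ t : Finset E, (t : Set E) ⊆ S ∧ t.card ≤ Module.finrank ℝ E ∧
      x ∈ convexHull ℝ (t : Set E) := by
  classical
  obtain ⟨ι, _, z, w, hz, hind, hw, hsum, rfl⟩ := eq_pos_convex_span_of_mem_convexHull hx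
  refine ⟨Finset.univ.image z, by simpa using hz, Finset.card_image_le.trans ?_,
    (convex_convexHull ℝ _).sum_mem (fun i _ => (hw i).le) hsum fun i _ =>
      subset_convexHull ℝ _ (by simp)⟩
  by_contra! hcard
  have hfull : Fintype.card ι = Module.finrank ℝ E + 1 :=
    (hind.card_le_finrank_succ.trans (Nat.succ_le_succ (Submodule.finrank_le _))).antisymm hcard
  let B : AffineBasis ι ℝ E :=
    ⟨z, hind, hind.affineSpan_eq_top_iff_card_eq_finrank_add_one.2 hfull⟩
  refine hint (interior_mono (convexHull_mono hz) (B.interior_convexHull.ge fun i => ?_))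
  rw [← Finset.univ.affineCombination_eq_linear_combination z w hsum]
  exact (B.coord_apply_combination_of_mem (Finset.mem_univ i) hsum).symm ▸ hw i

theorem exists_mem_segment_of_card_le_two {E : Type*} [AddCommGroup E] [Module ℝ E]
    {t : Finset E} (ht : t.card ≤ 2) {x : E} (hx : x ∈ convexHull ℝ (t : Set E)) :
    ∃ a ∈ t, ∃ b ∈ t, x ∈ segment ℝ a b := by
  classical
  have hne : t.Nonempty := Finset.coe_nonempty.1 (convexHull_nonempty_iff.1 ⟨x, hx⟩)
  obtain ⟨a, b, rfl⟩ : ∃ a b, t = {a, b} := by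
    rcases (Nat.succ_le_of_lt hne.card_pos).eq_or_lt with h | h
    · obtain ⟨a, rfl⟩ := Finset.card_eq_one.1 h.symm
      exact ⟨a, a, (Finset.pair_eq_singleton a).symm⟩
    · obtain ⟨a, b, -, rfl⟩ := Finset.card_eq_two.1 (ht.antisymm h)
      exact ⟨a, b, rfl⟩
  rw [Finset.coe_pair, convexHull_pair] at hx
  exact ⟨a, Finset.mem_insert_self _ _, b, by simp, hx⟩

theorem isBounded_connectedComponentIn_of_segment_subset {S K : Set Plane} {p : Plane}
    (hS : S.Finite) (hK : ∀ a ∈ S, ∀ b ∈ S, segment ℝ a b ⊆ K) (hp : p ∈ convexHull ℝ S)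
    (hpK : p ∉ K) : Bornology.IsBounded (connectedComponentIn Kᶜ p) := by
  have hint : ∀ x ∈ convexHull ℝ S, x ∉ K → x ∈ interior (convexHull ℝ S) := by
    intro x hx hxK
    by_contra hxint
    obtain ⟨t, htS, ht, hxt⟩ := exists_card_le_finrank_of_notMem_interior_convexHull hx hxint
    rw [finrank_euclideanSpace_fin] at ht
    obtain ⟨a, ha, b, hb, hab⟩ := exists_mem_segment_of_card_le_two ht hxt
    exact hxK (hK a (htS ha) b (htS hb) hab)
  refine (isBounded_convexHull.2 hS.isBounded).subset (Subset.trans ?_ interior_subset)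
  refine isPreconnected_connectedComponentIn.subset_left_of_subset_union isOpen_interior
    (hS.isClosed_convexHull ℝ).isOpen_compl (disjoint_compl_right.mono_left interior_subset)
    (fun x hx => ?_) ⟨p, mem_connectedComponentIn hpK, hint p hp hpK⟩
  by_cases hxS : x ∈ convexHull ℝ S
  · exact .inl (hint x hxS (connectedComponentIn_subset _ _ hx))
  · exact .inr hxS

theorem convexHull_subset_hull_straightConfiguration {P : Finset Plane}
    (hP : HasTransverseLines (P : Set Plane)) {S : Set Plane} (hS : S.Finite) :
    convexHull ℝ S ⊆ (straightConfiguration P hP).hull S := by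
  rintro p hp ⟨hpK, hunbounded⟩
  refine hunbounded (isBounded_connectedComponentIn_of_segment_subset hS (fun a ha b hb => ?_)
    hp hpK)
  rcases eq_or_ne a b with rfl | hab
  · rw [segment_same]
    exact singleton_subset_iff.2 (.inl ha)
  · exact fun x hx => .inr ⟨a, ha, b, hb, hab, segment_subset_pseudosegment hab hx⟩

section Projective

variable {E : Type*} [AddCommGroup E] [Module ℝ E] {D : E →ᵃ[ℝ] ℝ}

theorem convex_setOf_inv_smul_mem {C : Set E} (hC : Convex ℝ C) (D : E →ᵃ[ℝ] ℝ) :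
    Convex ℝ {x | 0 < D x ∧ (D x)⁻¹ • x ∈ C} := by
  rintro x ⟨hx, hxC⟩ y ⟨hy, hyC⟩ s t hs ht hst
  have hD : D (s • x + t • y) = s * D x + t * D y := Convex.combo_affine_apply hst
  have hpos : 0 < D (s • x + t • y) := convex_Ioi (0 : ℝ) |>.affine_preimage D hx hy hs ht hst
  refine ⟨hpos, ?_⟩
  have hcombo : (D (s • x + t • y))⁻¹ • (s • x + t • y) =
      (s * D x / D (s • x + t • y)) • (D x)⁻¹ • x +
        (t * D y / D (s • x + t • y)) • (D y)⁻¹ • y := by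
    rw [smul_add, smul_smul, smul_smul, smul_smul, smul_smul]
    congr 2 <;> field_simp
  rw [hcombo]
  refine hC hxC hyC (by positivity) (by positivity) ?_
  rw [← add_div, ← hD, div_self hpos.ne']

theorem inv_smul_mem_convexHull_image {S : Set E} (hS : ∀ x ∈ S, 0 < D x) {p : E}
    (hp : p ∈ convexHull ℝ S) :
    (D p)⁻¹ • p ∈ convexHull ℝ ((fun x => (D x)⁻¹ • x) '' S) :=
  (convexHull_min (t := {x | 0 < D x ∧
      (D x)⁻¹ • x ∈ convexHull ℝ ((fun x => (D x)⁻¹ • x) '' S)})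
    (fun x hx => ⟨hS x hx, subset_convexHull ℝ _ (mem_image_of_mem _ hx)⟩)
    (convex_setOf_inv_smul_mem (convex_convexHull ℝ _) D) hp).2

end Projective

/-- The denominator of `projectiveMap ε`, which is positive at a given point for small `ε`. -/
noncomputable def projectiveDenom (ε : ℝ) : Plane →ᵃ[ℝ] ℝ :=
  AffineMap.const ℝ Plane 1 +
    (ε • EuclideanSpace.projₗ 0 + ε ^ 2 • EuclideanSpace.projₗ 1 : Plane →ₗ[ℝ] ℝ).toAffineMap

/-- A projective map of the plane, close to the identity for small `ε`. Its line at infinity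
is `1 + ε * x + ε ^ 2 * y = 0`; it is used to make connecting lines transverse. -/
noncomputable def projectiveMap (ε : ℝ) (p : Plane) : Plane :=
  (projectiveDenom ε p)⁻¹ • p

section ProjectiveMap

variable {ε : ℝ} {a b c d p q : Plane}

theorem projectiveDenom_apply (ε : ℝ) (p : Plane) :
    projectiveDenom ε p = 1 + ε * p 0 + ε ^ 2 * p 1 := by
  simp [projectiveDenom, add_assoc]

theorem area_projectiveMap (ha : projectiveDenom ε a ≠ 0) (hb : projectiveDenom ε b ≠ 0)
    (hc : projectiveDenom ε c ≠ 0) :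
    area (projectiveMap ε a) (projectiveMap ε b) (projectiveMap ε c) *
      (projectiveDenom ε a * projectiveDenom ε b * projectiveDenom ε c) = area a b c := by
  have hdet : area a b c = a 0 * b 1 * projectiveDenom ε c + b 0 * c 1 * projectiveDenom ε a +
      c 0 * a 1 * projectiveDenom ε b - a 0 * c 1 * projectiveDenom ε b -
      b 0 * a 1 * projectiveDenom ε c - c 0 * b 1 * projectiveDenom ε a := by
    simp only [area, projectiveDenom_apply]
    ring
  rw [hdet]
  simp only [area, projectiveMap, PiLp.smul_apply, smul_eq_mul]
  field_simp
  ring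

theorem injOn_projectiveMap (ε : ℝ) : InjOn (projectiveMap ε) {p | projectiveDenom ε p ≠ 0} := by
  have hdenom : ∀ p, projectiveDenom ε p ≠ 0 →
      ε * projectiveMap ε p 0 + ε ^ 2 * projectiveMap ε p 1 = 1 - (projectiveDenom ε p)⁻¹ := by
    intro p hp
    simp only [projectiveMap, PiLp.smul_apply, smul_eq_mul]
    field_simp
    rw [projectiveDenom_apply]
    ring
  intro p hp q hq h
  have hinv : (projectiveDenom ε p)⁻¹ = (projectiveDenom ε q)⁻¹ := by
    rw [← sub_right_inj, ← hdenom p hp, ← hdenom q hq, h]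
  simp only [projectiveMap, hinv] at h
  exact (smul_right_injective Plane (inv_ne_zero hq)) h

theorem eventually_projectiveDenom_pos (p : Plane) :
    ∀ᶠ ε in 𝓝[>] (0 : ℝ), 0 < projectiveDenom ε p := by
  simp only [projectiveDenom_apply]
  refine eventually_nhdsWithin_of_eventually_nhds ?_
  have hcont : ContinuousAt (fun ε : ℝ => 1 + ε * p 0 + ε ^ 2 * p 1) 0 := by fun_prop
  exact hcont.eventually (lt_mem_nhds (by simp))

theorem eventually_eval_ne_zero {f : Polynomial ℝ} (hf : f ≠ 0) (x : ℝ) :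
    ∀ᶠ ε in 𝓝[>] x, f.eval ε ≠ 0 := by
  have hroots : ({ε | f.IsRoot ε} \ {x}).Finite :=
    (Polynomial.finite_setOfPred_isRoot hf).subset sdiff_subset
  filter_upwards [self_mem_nhdsWithin,
    mem_nhdsWithin_of_mem_nhds (hroots.isClosed.compl_mem_nhds (by simp))] with ε hε hroot h
  exact hroot ⟨h, ne_of_gt hε⟩

theorem eventually_mul_projectiveDenom_ne {u v : ℝ} (huv : u ≠ 0 ∨ v ≠ 0) (hcd : c ≠ d) :
    ∀ᶠ ε in 𝓝[>] (0 : ℝ), u * projectiveDenom ε c ≠ v * projectiveDenom ε d := by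
  let f : Cubic ℝ := ⟨0, u * c 1 - v * d 1, u * c 0 - v * d 0, u - v⟩
  have hf : f.toPoly ≠ 0 := by
    rw [Ne, Cubic.toPoly_eq_zero_iff]
    intro hf
    obtain rfl : u = v := sub_eq_zero.1 (congrArg Cubic.d hf)
    have hu : u ≠ 0 := or_self_iff.1 huv
    refine hcd (plane_ext ?_ ?_)
    · exact mul_left_cancel₀ hu (sub_eq_zero.1 (congrArg Cubic.c hf))
    · exact mul_left_cancel₀ hu (sub_eq_zero.1 (congrArg Cubic.b hf))
  filter_upwards [eventually_eval_ne_zero hf 0] with ε hε h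
  refine hε ?_
  simp only [projectiveDenom_apply] at h
  simp only [Cubic.toPoly, f, Polynomial.eval_add, Polynomial.eval_mul, Polynomial.eval_C,
    Polynomial.eval_X, Polynomial.eval_pow]
  linear_combination h

end ProjectiveMap

theorem InGeneralPosition.area_ne_zero {P : Finset Plane} (hP : InGeneralPosition P)
    {p q r : Plane} (hp : p ∈ P) (hq : q ∈ P) (hr : r ∈ P) (hpq : p ≠ q) (hpr : p ≠ r)
    (hqr : q ≠ r) : area p q r ≠ 0 := fun h =>
  hP p hp q hq r hr hpq hpr hqr (collinear_of_area_eq_zero hpq h)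

theorem InGeneralPosition.area_ne_zero_or_area_ne_zero {P : Finset Plane}
    (hP : InGeneralPosition P) {a b c d : Plane} (ha : a ∈ P) (hb : b ∈ P) (hc : c ∈ P)
    (hd : d ∈ P) (hab : a ≠ b) (hcd : c ≠ d) (hne : s(a, b) ≠ s(c, d)) :
    area a b c ≠ 0 ∨ area a b d ≠ 0 := by
  by_cases hc' : a ≠ c ∧ b ≠ c
  · exact .inl (hP.area_ne_zero ha hb hc hab hc'.1 hc'.2)
  · refine .inr (hP.area_ne_zero ha hb hd hab ?_ ?_) <;> rintro rfl <;> apply hne <;> aesop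

theorem InGeneralPosition.eventually_hasTransverseLines {P : Finset Plane}
    (hP : InGeneralPosition P) :
    ∀ᶠ ε in 𝓝[>] (0 : ℝ), (∀ p ∈ P, 0 < projectiveDenom ε p) ∧
      HasTransverseLines (projectiveMap ε '' P) := by
  have hpos : ∀ᶠ ε in 𝓝[>] (0 : ℝ), ∀ p ∈ P, 0 < projectiveDenom ε p :=
    (Finset.eventually_all P).2 fun p _ => eventually_projectiveDenom_pos p
  have hne : ∀ᶠ ε in 𝓝[>] (0 : ℝ), ∀ a ∈ P, ∀ b ∈ P, ∀ c ∈ P, ∀ d ∈ P,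
      a ≠ b → c ≠ d → s(a, b) ≠ s(c, d) →
        area a b c * projectiveDenom ε d ≠ area a b d * projectiveDenom ε c := by
    refine (Finset.eventually_all P).2 fun a ha => (Finset.eventually_all P).2 fun b hb =>
      (Finset.eventually_all P).2 fun c hc => (Finset.eventually_all P).2 fun d hd => ?_
    simp only [eventually_imp_distrib_left]
    intro hab hcd hne
    exact eventually_mul_projectiveDenom_ne
      (hP.area_ne_zero_or_area_ne_zero ha hb hc hd hab hcd hne) hcd.symm
  filter_upwards [hpos, hne] with ε hpos hne
  refine ⟨hpos, ?_⟩
  rintro _ ⟨a, ha, rfl⟩ _ ⟨b, hb, rfl⟩ _ ⟨c, hc, rfl⟩ _ ⟨d, hd, rfl⟩ hab hcd hne' h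
  refine hne a ha b hb c hc d hd (ne_of_apply_ne _ hab) (ne_of_apply_ne _ hcd)
    (fun e => hne' (congrArg (Sym2.map (projectiveMap ε)) e)) ?_
  have hpos' : ∀ p ∈ P, projectiveDenom ε p ≠ 0 := fun p hp => (hpos p hp).ne'
  rw [← area_projectiveMap (hpos' a ha) (hpos' b hb) (hpos' c hc),
    ← area_projectiveMap (hpos' a ha) (hpos' b hb) (hpos' d hd), h]
  ring

theorem ClassicalESProperty.of_pseudo {n N : ℕ} (h : PseudoESProperty n N) :
    ClassicalESProperty n N := by
  classical
  intro P hP hN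
  obtain ⟨ε, hpos, hlines⟩ := hP.eventually_hasTransverseLines.exists
  have hinj : InjOn (projectiveMap ε) P :=
    (injOn_projectiveMap ε).mono fun p hp => (hpos p hp).ne'
  rw [← Finset.coe_image] at hlines
  obtain ⟨Q', hcard, hsub, hQ'⟩ := h (straightConfiguration _ hlines)
    (hN.trans_eq (Finset.card_image_of_injOn hinj).symm)
  obtain ⟨Q, hQP, rfl⟩ := Finset.subset_image_iff.1 hsub
  have hinjQ : InjOn (projectiveMap ε) Q := hinj.mono hQP
  refine ⟨Q, hQP, (Finset.card_image_of_injOn hinjQ).symm.trans hcard, fun p hp hpc => ?_⟩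
  refine hQ' _ (Finset.mem_image_of_mem _ hp)
    (convexHull_subset_hull_straightConfiguration hlines (Finset.finite_toSet _).sdiff ?_)
  refine convexHull_mono ?_ (inv_smul_mem_convexHull_image (fun x hx => hpos x (hQP hx.1)) hpc)
  rintro _ ⟨x, hx, rfl⟩
  exact ⟨Finset.mem_coe.2 (Finset.mem_image_of_mem _ hx.1), fun e => hx.2 (hinjQ hx.1 hp e)⟩

theorem theorem3 :
    ∃ b e : ℕ → ℕ,
      (∀ n : ℕ, 3 ≤ n → IsLeast {N : ℕ | PseudoESProperty n N} (b n)) ∧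
      (∀ n : ℕ, 3 ≤ n → IsLeast {N : ℕ | ClassicalESProperty n N} (e n)) ∧
      (∃ C : ℝ, ∀ n : ℕ, 3 ≤ n →
        (b n : ℝ) ≤ (2 : ℝ) ^ ((n : ℝ) + C * Real.sqrt ((n : ℝ) * Real.log (n : ℝ)))) ∧
      (∀ n : ℕ, 3 ≤ n → e n ≤ b n) := by
  have hb : ∀ n : ℕ, 3 ≤ n → IsLeast {N : ℕ | PseudoESProperty n N}
      (sInf {N : ℕ | PseudoESProperty n N}) := fun n hn =>
    ⟨Nat.sInf_mem ⟨_, pseudoESProperty_floor hn⟩, fun _ hN => Nat.sInf_le hN⟩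
  have he : ∀ n : ℕ, 3 ≤ n → IsLeast {N : ℕ | ClassicalESProperty n N}
      (sInf {N : ℕ | ClassicalESProperty n N}) := fun n hn =>
    ⟨Nat.sInf_mem ⟨_, .of_pseudo (pseudoESProperty_floor hn)⟩, fun _ hN => Nat.sInf_le hN⟩
  refine ⟨_, _, hb, he, ⟨100, fun n hn => ?_⟩, fun n hn => (he n hn).2 (.of_pseudo (hb n hn).1)⟩
  exact (Nat.cast_le.2 ((hb n hn).2 (pseudoESProperty_floor hn))).trans
    (Nat.floor_le (by positivity))
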